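/- Let $A$ be an associative ring with $1$, with an involution $a\mapsto\overline a$ (an additive anti-automorphism of $A$ whose square is the identity), let $\lambda\in A$ be central with $\lambda\overline\lambda=1$, and let $\Lambda$ be a form parameter: an additive subgroup of $A$ with $\{c-\lambda\overline c: c\in A\}\subseteq\Lambda\subseteq\{c\in A: c=-\lambda\overline c\}$ and $c\Lambda\overline c\subseteq\Lambda$ for all $c\in A$. Let $(I,\Gamma)$ and $(J,\Delta)$ be form ideals of the form ring $(A,\Lambda)$; that is, $I$ is a two-sided ideal with $\overline I=I$ and $\Gamma$ is an additive subgroup with $\Gamma_{\min}(I)\subseteq\Gamma\subseteq I\cap\Lambda$ and $c\Gamma\overline c\subseteq\Gamma$ for all $c\in A$, where $\Gamma_{\min}(I)$ is the additive subgroup generated by all $a-\lambda\overline a$ and $ac\overline a$ with $a\in I$, $c\in\Lambda$; and similarly for $(J,\Delta)$. Their symmetrised product is the form ideal $$(I,\Gamma)\circ(J,\Delta)=\big(IJ+JI,\ \Gamma_{\min}(IJ+JI)+\langle b\Gamma\overline b: b\in J\rangle+\langle a\Delta\overline a: a\in I\rangle\big).$$ Let $n\ge 3$, $\Omega=\{1,\dots,n,-n,\dots,-1\}$,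 and let $\varepsilon(i)=\pm1$ be the sign of $i\in\Omega$. In $\mathrm{GL}(2n,A)$, with rows and columns indexed by $\Omega$, put $T_{i,-i}(c)=e+c\,e_{i,-i}$, and $T_{ij}(c)=e+c\,e_{ij}-\lambda^{(\varepsilon(j)-\varepsilon(i))/2}\,\overline c\,e_{-j,-i}$ for $i\ne\pm j$. For a form ideal $(K,\Theta)$ (including $(A,\Lambda)$ itself), write $a\in(K,\Theta)_{ij}$ if $i\neq\pm j$ and $a\in K$, or if $j=-i$ and $a\in\lambda^{-(\varepsilon(i)+1)/2}\Theta$. Let $\mathrm{FU}(2n,K,\Theta)$ be the group generated by all $T_{ij}(a)$, $i\ne j$, $a\in(K,\Theta)_{ij}$; put $\mathrm{EU}(2n,A,\Lambda)=\mathrm{FU}(2n,A,\Lambda)$, and let $\mathrm{EU}(2n,K,\Theta)$ be the normal closure of $\mathrm{FU}(2n,K,\Theta)$ in $\mathrm{EU}(2n,A,\Lambda)$. Finally put $$Z_{ij}(a,c)=T_{ji}(c)\,T_{ij}(a)\,T_{ji}(-c),\qquad Y_{ij}(a,b)=[T_{ji}(a),T_{ij}(b)],\qquad [x,y]=xyx^{-1}y^{-1}.$$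 Then the mixed commutator subgroup $[\mathrm{EU}(2n,I,\Gamma),\mathrm{EU}(2n,J,\Delta)]$ is generated, as a group, by the following elements of two types: 1. the elementary conjugates $Z_{ij}(ab,c)$ and $Z_{ij}(ba,c)$ with $i\neq\pm j$, $a\in I$, $b\in J$, $c\in A$, and, in long root positions, $Z_{i,-i}(x,c)$ with $x\in\big((I,\Gamma)\circ(J,\Delta)\big)_{i,-i}$ and $c\in(A,\Lambda)_{-i,i}$; 2. the elementary commutators $Y_{ij}(a,b)$ with $i\ne j$, $a\in(I,\Gamma)_{ji}$, $b\in(J,\Delta)_{ij}$. Moreover, among the generators of type 2 it suffices to take those in a single pair of short root type and a single pair of long root type: for any fixed $h,k\in\Omega$ with $h\neq\pm k$ and any fixed $l\in\Omega$, the group is already generated by all elements of type 1 together with the $Y_{hk}(a,b)$, $a\in I$, $b\in J$, and the $Y_{l,-l}(a,b)$, $a\in(I,\Gamma)_{-l,l}$, $b\in(J,\Delta)_{l,-l}$. -/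

import Mathlib

/-- A form ring structure `(A, Λ)` on an associative ring `A` with `1` and an involution
`a ↦ star a`: a central symmetry `lam` with `lam * star lam = 1`, and a form parameter `Lam`. -/
structure FormRing (A : Type*) [Ring A] [StarRing A] where
  /-- the symmetry `λ` -/
  lam : A
  lam_central : ∀ a : A, lam * a = a * lam
  lam_mul_star : lam * star lam = 1
  /-- the form parameter `Λ` -/
  Lam : AddSubgroup A
  /-- `Λ_min ⊆ Λ` -/
  min_le : ∀ c : A, c - lam * star c ∈ Lam
  /-- `Λ ⊆ Λ_max` -/
  le_max : ∀ c ∈ Lam, c = -(lam * star c)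
  conj_mem : ∀ c : A, ∀ x ∈ Lam, c * x * star c ∈ Lam

namespace FormRing

variable {A : Type*} [Ring A] [StarRing A]

/-- `λ` as a unit of `A`; its inverse is `star λ`. -/
def lamUnit (F : FormRing A) : Aˣ where
  val := F.lam
  inv := star F.lam
  val_inv := F.lam_mul_star
  inv_val := by rw [← F.lam_central]; exact F.lam_mul_star

/-- The integral power `λ ^ k`, as an element of `A`. -/
def lamPow (F : FormRing A) (k : ℤ) : A := ((F.lamUnit ^ k : Aˣ) : A)

/-- `Γ_min(I)`. -/
def gammaMin (F : FormRing A) (I : Ideal A) : AddSubgroup A :=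
  AddSubgroup.closure
    ({x | ∃ a ∈ I, x = a - F.lam * star a} ∪ {x | ∃ a ∈ I, ∃ c ∈ F.Lam, x = a * c * star a})

end FormRing

/-- A form ideal `(I, Γ)` of the form ring `(A, Λ)`: an involution invariant two-sided ideal `I`
and a relative form parameter `Γ` of level `I`. -/
structure FormIdeal {A : Type*} [Ring A] [StarRing A] (F : FormRing A) where
  I : Ideal A
  twoSided : I.IsTwoSided
  star_mem : ∀ a ∈ I, star a ∈ I
  Gam : AddSubgroup A
  min_le : F.gammaMin I ≤ Gam
  /-- `Γ ⊆ Γ_max(I) = I ∩ Λ` -/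
  le_max : ∀ x ∈ Gam, x ∈ I ∧ x ∈ F.Lam
  conj_mem : ∀ c : A, ∀ x ∈ Gam, c * x * star c ∈ Gam

namespace FormIdeal

variable {A : Type*} [Ring A] [StarRing A] {F : FormRing A}

/-- The underlying ideal `I ∘ J = IJ + JI` of the symmetrised product. -/
def circIdeal (P Q : FormIdeal F) : Ideal A := P.I * Q.I ⊔ Q.I * P.I

/-- `{}^J Γ`, the additive subgroup generated by all `b x star b` with `b ∈ J`, `x ∈ Γ`. -/
def conjForm (J : Ideal A) (G : AddSubgroup A) : AddSubgroup A :=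
  AddSubgroup.closure {y | ∃ b ∈ J, ∃ x ∈ G, y = b * x * star b}

/-- `Γ ∘ Δ = Γ_min(IJ + JI) + {}^J Γ + {}^I Δ`. -/
def circGam (P Q : FormIdeal F) : AddSubgroup A :=
  F.gammaMin (circIdeal P Q) ⊔ conjForm Q.I P.Gam ⊔ conjForm P.I Q.Gam

theorem circIdeal_twoSided (P Q : FormIdeal F) : (circIdeal P Q).IsTwoSided := by
  have := P.twoSided
  have := Q.twoSided
  refine ⟨fun {a} b ha => ?_⟩
  obtain ⟨x, hx, y, hy, rfl⟩ := Submodule.mem_sup.1 ha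
  rw [add_mul]
  exact add_mem (Ideal.mem_sup_left (Ideal.mul_mem_right _ _ hx))
    (Ideal.mem_sup_right (Ideal.mul_mem_right _ _ hy))

theorem star_mem_mul {I J : Ideal A} (hI' : ∀ a ∈ I, star a ∈ I)
    (hJ' : ∀ a ∈ J, star a ∈ J) {x : A} (hx : x ∈ I * J) : star x ∈ J * I := by
  induction hx using Submodule.mul_induction_on' with
  | mem_mul_mem m hm k hk => rw [star_mul]; exact Ideal.mul_mem_mul (hJ' _ hk) (hI' _ hm)
  | add x _ y _ hx hy => rw [star_add]; exact add_mem hx hy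

theorem circIdeal_star_mem (P Q : FormIdeal F) (a : A) (ha : a ∈ circIdeal P Q) :
    star a ∈ circIdeal P Q := by
  obtain ⟨x, hx, y, hy, rfl⟩ := Submodule.mem_sup.1 ha
  rw [star_add]
  exact add_mem
    (Ideal.mem_sup_right (star_mem_mul P.star_mem Q.star_mem hx))
    (Ideal.mem_sup_left (star_mem_mul Q.star_mem P.star_mem hy))

/-- Induction principle for `Γ ∘ Δ`. -/
theorem circGam_le (P Q : FormIdeal F) (S : AddSubgroup A)
    (h1 : ∀ a ∈ circIdeal P Q, a - F.lam * star a ∈ S)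
    (h2 : ∀ a ∈ circIdeal P Q, ∀ c ∈ F.Lam, a * c * star a ∈ S)
    (h3 : ∀ b ∈ Q.I, ∀ x ∈ P.Gam, b * x * star b ∈ S)
    (h4 : ∀ a ∈ P.I, ∀ x ∈ Q.Gam, a * x * star a ∈ S) : circGam P Q ≤ S := by
  refine sup_le (sup_le ?_ ?_) ?_
  · refine (AddSubgroup.closure_le _).2 ?_
    rintro _ (⟨a, ha, rfl⟩ | ⟨a, ha, c, hc, rfl⟩)
    · exact h1 a ha
    · exact h2 a ha c hc
  · refine (AddSubgroup.closure_le _).2 ?_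
    rintro _ ⟨b, hb, x, hx, rfl⟩
    exact h3 b hb x hx
  · refine (AddSubgroup.closure_le _).2 ?_
    rintro _ ⟨b, hb, x, hx, rfl⟩
    exact h4 b hb x hx

theorem circGam_le_ideal (P Q : FormIdeal F) (x : A) (hx : x ∈ circGam P Q) :
    x ∈ circIdeal P Q := by
  have hT := circIdeal_twoSided P Q
  have key : circGam P Q ≤ (circIdeal P Q).toAddSubgroup := by
    refine circGam_le P Q _ ?_ ?_ ?_ ?_
    · intro a ha
      exact sub_mem ha (Ideal.mul_mem_left _ _ (circIdeal_star_mem P Q a ha))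
    · intro a ha c _
      exact Ideal.mul_mem_right _ _ (Ideal.mul_mem_right _ _ ha)
    · intro b hb y hy
      exact Ideal.mul_mem_right _ _
        (Ideal.mem_sup_right (Ideal.mul_mem_mul hb (P.le_max y hy).1))
    · intro b hb y hy
      exact Ideal.mul_mem_right _ _
        (Ideal.mem_sup_left (Ideal.mul_mem_mul hb (Q.le_max y hy).1))
  exact key hx

theorem circGam_le_Lam (P Q : FormIdeal F) (x : A) (hx : x ∈ circGam P Q) : x ∈ F.Lam := by
  refine circGam_le P Q F.Lam (fun a _ => F.min_le a) (fun a _ c hc => F.conj_mem a c hc)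
    (fun b _ y hy => F.conj_mem b y (P.le_max y hy).2)
    (fun b _ y hy => F.conj_mem b y (Q.le_max y hy).2) hx

theorem circGam_conj_mem (P Q : FormIdeal F) (c x : A) (hx : x ∈ circGam P Q) :
    c * x * star c ∈ circGam P Q := by
  have hT := circIdeal_twoSided P Q
  let f : A →+ A := (AddMonoidHom.mulRight (star c)).comp (AddMonoidHom.mulLeft c)
  have key : circGam P Q ≤ (circGam P Q).comap f := by
    refine circGam_le P Q _ ?_ ?_ ?_ ?_
    · intro a ha
      change c * (a - F.lam * star a) * star c ∈ circGam P Q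
      refine AddSubgroup.mem_sup_left (AddSubgroup.mem_sup_left
        (AddSubgroup.subset_closure (Or.inl ⟨c * a * star c,
          Ideal.mul_mem_right _ _ (Ideal.mul_mem_left _ _ ha), ?_⟩)))
      simp only [star_mul, star_star, mul_sub, sub_mul]
      simp only [← mul_assoc]
      rw [← F.lam_central c]
    · intro a ha y hy
      change c * (a * y * star a) * star c ∈ circGam P Q
      refine AddSubgroup.mem_sup_left (AddSubgroup.mem_sup_left
        (AddSubgroup.subset_closure (Or.inr ⟨c * a, Ideal.mul_mem_left _ _ ha, y, hy, ?_⟩)))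
      simp only [star_mul, mul_assoc]
    · intro b hb y hy
      change c * (b * y * star b) * star c ∈ circGam P Q
      refine AddSubgroup.mem_sup_left (AddSubgroup.mem_sup_right
        (AddSubgroup.subset_closure ⟨c * b, Ideal.mul_mem_left _ _ hb, y, hy, ?_⟩))
      simp only [star_mul, mul_assoc]
    · intro b hb y hy
      change c * (b * y * star b) * star c ∈ circGam P Q
      refine AddSubgroup.mem_sup_right
        (AddSubgroup.subset_closure ⟨c * b, Ideal.mul_mem_left _ _ hb, y, hy, ?_⟩)
      simp only [star_mul, mul_assoc]
  exact key hx

/-- The symmetrised product `(I, Γ) ∘ (J, Δ)` of two form ideals. -/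
def circ (P Q : FormIdeal F) : FormIdeal F where
  I := circIdeal P Q
  twoSided := circIdeal_twoSided P Q
  star_mem := circIdeal_star_mem P Q
  Gam := circGam P Q
  min_le := le_trans le_sup_left le_sup_left
  le_max := fun x hx => ⟨circGam_le_ideal P Q x hx, circGam_le_Lam P Q x hx⟩
  conj_mem := fun c x hx => circGam_conj_mem P Q c x hx

end FormIdeal

/-- The index set `Ω = {1, …, n, -n, …, -1}`: `Sum.inl` is `Ω⁺`, `Sum.inr` is `Ω⁻`. -/
abbrev Idx (n : ℕ) : Type := Fin n ⊕ Fin n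

namespace Idx

/-- The involution `i ↦ -i` of `Ω`. -/
def opp {n : ℕ} (i : Idx n) : Idx n := Sum.swap i

/-- The sign `ε(i)`. -/
def sgn {n : ℕ} : Idx n → ℤ
  | Sum.inl _ => 1
  | Sum.inr _ => -1

theorem opp_opp {n : ℕ} (i : Idx n) : i.opp.opp = i := Sum.swap_swap i

theorem opp_ne {n : ℕ} (i : Idx n) : i.opp ≠ i := by
  cases i <;> simp [opp]

end Idx

namespace FormRing

variable {A : Type*} [Ring A] [StarRing A]

/-- The matrix of the elementary unitary transvection `T_ij(c)`, for `i ≠ j`: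
`e + c e_{i,-i}` if `j = -i`, and `e + c e_{ij} - λ^((ε(j)-ε(i))/2) (star c) e_{-j,-i}` otherwise. -/
def tMat (F : FormRing A) {n : ℕ} (i j : Idx n) (c : A) : Matrix (Idx n) (Idx n) A :=
  if j = i.opp then 1 + Matrix.single i j c
  else 1 + Matrix.single i j c
    - Matrix.single j.opp i.opp (F.lamPow ((j.sgn - i.sgn) / 2) * star c)

theorem tMat_mul_neg (F : FormRing A) {n : ℕ} {i j : Idx n} (hij : i ≠ j) (c : A) :
    F.tMat i j c * F.tMat i j (-c) = 1 := by
  have hji : j ≠ i := fun h => hij h.symm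
  have ho : i.opp ≠ j.opp := fun h => hij (by rw [← i.opp_opp, h, j.opp_opp])
  have hi := i.opp_ne
  have hj := j.opp_ne
  unfold tMat
  split_ifs with h
  · have e1 : Matrix.single i j c * Matrix.single i j c = 0 :=
      Matrix.single_mul_single_of_ne _ _ _ _ hji _
    rw [← Matrix.single_neg]
    simp only [mul_add, add_mul, mul_neg, one_mul, mul_one, e1]
    abel
  · rw [star_neg, mul_neg, ← Matrix.single_neg, ← Matrix.single_neg]
    set d := F.lamPow ((j.sgn - i.sgn) / 2) * star c
    have e1 : Matrix.single i j c * Matrix.single i j c = 0 :=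
      Matrix.single_mul_single_of_ne _ _ _ _ hji _
    have e2 : Matrix.single i j c * Matrix.single j.opp i.opp d = 0 :=
      Matrix.single_mul_single_of_ne _ _ _ _ hj.symm _
    have e3 : Matrix.single j.opp i.opp d * Matrix.single i j c = 0 :=
      Matrix.single_mul_single_of_ne _ _ _ _ hi _
    have e4 : Matrix.single j.opp i.opp d * Matrix.single j.opp i.opp d = 0 :=
      Matrix.single_mul_single_of_ne _ _ _ _ ho _
    simp only [mul_add, add_mul, mul_sub, sub_mul, mul_neg, one_mul, mul_one, e1, e2, e3, e4]
    abel

/-- The elementary unitary transvection `T_ij(c)` as an element of `GL(2n, A)`. It is used only for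
`i ≠ j`, and equals `1` by convention if `i = j`. -/
def T (F : FormRing A) {n : ℕ} (i j : Idx n) (c : A) : (Matrix (Idx n) (Idx n) A)ˣ :=
  if hij : i ≠ j then
    { val := F.tMat i j c
      inv := F.tMat i j (-c)
      val_inv := F.tMat_mul_neg hij c
      inv_val := by simpa using F.tMat_mul_neg hij (-c) }
  else 1

/-- For an ideal `I` and an additive subgroup `Γ`, the set of admissible arguments of `T_ij` at
level `(I, Γ)`: the ideal `I` if `i ≠ ±j`, and `λ^(-(ε(i)+1)/2) Γ` if `j = -i`. -/
def level (F : FormRing A) (I : Ideal A) (G : AddSubgroup A) {n : ℕ} (i j : Idx n) : Set A :=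
  if j = i.opp then {a | ∃ x ∈ G, a = F.lamPow (-(i.sgn + 1) / 2) * x} else {a | a ∈ I}

/-- The subgroup generated by the elementary unitary transvections of level `(I, Γ)`. -/
def elem (F : FormRing A) (n : ℕ) (I : Ideal A) (G : AddSubgroup A) :
    Subgroup (Matrix (Idx n) (Idx n) A)ˣ :=
  Subgroup.closure {g | ∃ i j : Idx n, i ≠ j ∧ ∃ a ∈ F.level I G i j, g = F.T i j a}

/-- The absolute elementary unitary group `EU(2n, A, Λ)`. -/
def absEU (F : FormRing A) (n : ℕ) : Subgroup (Matrix (Idx n) (Idx n) A)ˣ :=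
  F.elem n ⊤ F.Lam

/-- The elementary conjugate `Z_ij(a, c) = T_ji(c) T_ij(a) T_ji(-c)`. -/
def Z (F : FormRing A) {n : ℕ} (i j : Idx n) (a c : A) : (Matrix (Idx n) (Idx n) A)ˣ :=
  F.T j i c * F.T i j a * F.T j i (-c)

/-- The elementary commutator `Y_ij(a, b) = [T_ji(a), T_ij(b)]`. -/
def Y (F : FormRing A) {n : ℕ} (i j : Idx n) (a b : A) : (Matrix (Idx n) (Idx n) A)ˣ :=
  F.T j i a * F.T i j b * (F.T j i a)⁻¹ * (F.T i j b)⁻¹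

end FormRing

namespace FormIdeal

variable {A : Type*} [Ring A] [StarRing A] {F : FormRing A}

/-- The arguments `a ∈ (I, Γ)` in position `(i, j)`. -/
def lev (P : FormIdeal F) {n : ℕ} (i j : Idx n) : Set A := F.level P.I P.Gam i j

/-- The unrelative elementary subgroup `FU(2n, I, Γ)`. -/
def FU (P : FormIdeal F) (n : ℕ) : Subgroup (Matrix (Idx n) (Idx n) A)ˣ :=
  F.elem n P.I P.Gam

/-- The relative elementary subgroup `EU(2n, I, Γ)`: the normal closure of `FU(2n, I, Γ)` in
`EU(2n, A, Λ)`. -/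
def EU (P : FormIdeal F) (n : ℕ) : Subgroup (Matrix (Idx n) (Idx n) A)ˣ :=
  Subgroup.closure {g | ∃ x ∈ F.absEU n, ∃ y ∈ P.FU n, g = x * y * x⁻¹}

/-- Short root elementary conjugates `Z_ij(ab, c)` and `Z_ij(ba, c)`,
`i ≠ ±j`, `a ∈ I`, `b ∈ J`, `c ∈ A`. -/
def shortZ (P Q : FormIdeal F) (n : ℕ) : Set (Matrix (Idx n) (Idx n) A)ˣ :=
  {g | ∃ i j : Idx n, i ≠ j ∧ j ≠ i.opp ∧ ∃ a ∈ P.I, ∃ b ∈ Q.I, ∃ c : A,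
    g = F.Z i j (a * b) c ∨ g = F.Z i j (b * a) c}

/-- Long root elementary conjugates `Z_{i,-i}(x, c)`, where the argument `x` runs over the long root
component of `(I, Γ) ∘ (J, Δ)` and `c` over the long root component of `(A, Λ)` in the
opposite position. -/
def longZ (P Q : FormIdeal F) (n : ℕ) : Set (Matrix (Idx n) (Idx n) A)ˣ :=
  {g | ∃ i : Idx n, ∃ x ∈ (P.circ Q).lev i i.opp, ∃ c ∈ F.level ⊤ F.Lam i.opp i,
    g = F.Z i i.opp x c}

/-- The elementary commutators `Y_ij(a, b)` in the fixed position `(i, j)`, with `a ∈ (I, Γ)`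
and `b ∈ (J, Δ)`. -/
def commY (P Q : FormIdeal F) {n : ℕ} (i j : Idx n) : Set (Matrix (Idx n) (Idx n) A)ˣ :=
  {g | ∃ a ∈ P.lev j i, ∃ b ∈ Q.lev i j, g = F.Y i j a b}

end FormIdeal

/-!
The transvections `T_ij` are organised into root subgroups for the root system of type `C_n`, the
root of `T_ij` being `e_i - e_j` with `e_{-i} = -e_i`. Three facts about them are used: the
Chevalley commutator formula for roots `v`, `w` with `v + w ≠ 0`, in which the commutator of levels
`(I, Γ)` and `(J, Δ)` has level `(I, Γ) ∘ (J, Δ)` (`commutator_mem_of_add_ne_zero`); the existence,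
for non-proportional roots `v`, `w`, of a linear functional that vanishes on `v` and is positive on
`w` (`exists_functional`), which puts `w` into the unipotent radical of a parabolic subgroup whose
Levi part contains `v`; and, as `n ≥ 3`, the fact that a root subgroup is generated, together with
conjugation, by those for a set `R` of roots with `±v ∉ R` and `R ∩ -R = ∅`
(`exists_generating_roots`).

Relative elementary groups are generated by the elementary conjugates (`EU_eq_genConj`): conjugation
by the root subgroup for `w` preserves the group generated by the conjugates for a set `S` of roots
if `w ∉ S` and `-w ∈ S`; for the one critical case, a conjugate for `w` itself, one takes
`S = {w} ∪ -R` and generates the root subgroup for `w` from `R`. In particular the given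
elementary conjugates generate `K = EU((I, Γ) ∘ (J, Δ))`, and the commutator formulas give that `K` is contained
in the mixed commutator subgroup (`EU_circ_le_commutator`).

An elementary commutator for `v` is central modulo `K` (`absEU_le_centMod_commutator`): conjugating
it by a root element for `w ≠ ±v` changes its entries by elements of a unipotent radical, and the
root subgroups for `±v` are generated by the others. Hence the subgroup `H` generated by `K` and the
elementary commutators for one short and one long root is normalised by `EU(2n, A, Λ)`, and it
remains to see that the two relative groups commute modulo `H`. For root subgroups this is the
commutator formula unless the roots are opposite, and opposite roots are reached from the two
given ones by writing `T_ij(b)` as a product of `T_ik(b)` and a conjugate of its inverse by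
`T_kj(1)`, and similarly for long roots (`FU_le_centMod_FU`). Elementary conjugates are treated by
moving the conjugation to the other argument, the critical case of equal roots being again reduced
by generating the transvection from `R` (`commutator_EU_le`).
-/

/-! ### The units `λ_i` and the levels -/

namespace Idx

variable {n : ℕ}

theorem opp_inj {i j : Idx n} : i.opp = j.opp ↔ i = j :=
  ⟨fun h => by rw [← i.opp_opp, h, j.opp_opp], fun h => by rw [h]⟩

theorem eq_opp_comm {i j : Idx n} : i = j.opp ↔ j = i.opp :=
  ⟨fun h => by rw [h, opp_opp], fun h => by rw [h, opp_opp]⟩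

end Idx

namespace FormRing

variable {A : Type*} [Ring A] [StarRing A] (F : FormRing A) {n : ℕ}

/-- The unit `λ_i = λ^((ε(i)+1)/2)`, which is `λ` for `i > 0` and `1` for `i < 0`. All powers of `λ`
in the definition of the transvections are quotients of these. -/
def lamI : Idx n → A
  | Sum.inl _ => F.lam
  | Sum.inr _ => 1

/-- The coefficient `λ^((ε(j)-ε(i))/2) = λ_j λ_i⁻¹`. -/
def mu (i j : Idx n) : A := F.lamI j * star (F.lamI i)

theorem star_lam_mul : star F.lam * F.lam = 1 := by rw [← F.lam_central, F.lam_mul_star]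

theorem lamI_central (i : Idx n) (a : A) : F.lamI i * a = a * F.lamI i := by
  cases i <;> simp [lamI, F.lam_central]

theorem star_lamI_central (i : Idx n) (a : A) : star (F.lamI i) * a = a * star (F.lamI i) := by
  have := congrArg star (F.lamI_central i (star a))
  simpa using this.symm

theorem lamI_mul_star (i : Idx n) : F.lamI i * star (F.lamI i) = 1 := by
  cases i <;> simp [lamI, F.lam_mul_star]

theorem star_lamI_mul (i : Idx n) : star (F.lamI i) * F.lamI i = 1 := by
  cases i <;> simp [lamI, F.star_lam_mul]

theorem lamI_mul_lamI_opp (i : Idx n) : F.lamI i * F.lamI i.opp = F.lam := by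
  cases i <;> simp [lamI, Idx.opp]

theorem star_lamI_mul_cancel (i : Idx n) (a : A) : star (F.lamI i) * (F.lamI i * a) = a := by
  rw [← mul_assoc, star_lamI_mul, one_mul]

theorem lamI_mul_cancel (i : Idx n) (a : A) : F.lamI i * (star (F.lamI i) * a) = a := by
  rw [← mul_assoc, lamI_mul_star, one_mul]

theorem lamPow_eq_mu (i j : Idx n) : F.lamPow ((j.sgn - i.sgn) / 2) = F.mu i j := by
  cases i <;> cases j <;>
    simp [lamPow, mu, lamI, Idx.sgn, F.lam_mul_star, lamUnit]

theorem lamPow_eq_star_lamI (i : Idx n) : F.lamPow (-(i.sgn + 1) / 2) = star (F.lamI i) := by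
  cases i <;> simp [lamPow, lamI, Idx.sgn, lamUnit]

theorem mu_central (i j : Idx n) (a : A) : F.mu i j * a = a * F.mu i j := by
  rw [mu, mul_assoc, star_lamI_central, ← mul_assoc, lamI_central, mul_assoc]

theorem mu_mul_mu (i j k : Idx n) : F.mu i j * F.mu j k = F.mu i k := by
  rw [mu_central, mu, mu, mu, mul_assoc, ← mul_assoc _ (F.lamI j), star_lamI_mul, one_mul]

theorem mu_self (i : Idx n) : F.mu i i = 1 := F.lamI_mul_star i

theorem star_mu (i j : Idx n) : star (F.mu i j) = F.mu j i := by
  simp [mu]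

theorem mu_opp (i j : Idx n) : F.mu j.opp i.opp = F.mu i j := by
  cases i <;> cases j <;> simp [mu, lamI, Idx.opp, F.lam_mul_star]

theorem mu_opp_left (i j : Idx n) : F.mu i.opp j = F.mu j.opp i := by
  rw [← F.mu_opp, Idx.opp_opp]

theorem mu_mul_mu_assoc (i j k : Idx n) (a : A) : F.mu i j * (F.mu j k * a) = F.mu i k * a := by
  rw [← mul_assoc, mu_mul_mu]

theorem lamI_mul_mu (i j : Idx n) : F.lamI i * F.mu i j = F.lamI j := by
  rw [lamI_central, mu, mul_assoc, star_lamI_mul, mul_one]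

theorem star_of_mem_Lam {x : A} (hx : x ∈ F.Lam) : star x = -(star F.lam * x) := by
  have h := F.le_max x hx
  have : star F.lam * x = - star x := by
    conv_lhs => rw [h]
    rw [mul_neg, ← mul_assoc, star_lam_mul, one_mul]
  rw [this, neg_neg]

/-- An admissible argument `a` of the long root transvection `T_{i,-i}` satisfies
`star a = - μ a`; this is what makes `T_ij(a) = T_{-j,-i}(-μ star a)` consistent for `j = -i`. -/
theorem star_of_lamI_mul_mem {i : Idx n} {a : A} (ha : F.lamI i * a ∈ F.Lam) :
    star a = -(F.mu i.opp i * a) := by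
  have h := F.star_of_mem_Lam ha
  rw [star_mul, ← F.star_lamI_central] at h
  have h2 : star a = F.lamI i * (-(star F.lam * (F.lamI i * a))) := by
    rw [← h, lamI_mul_cancel]
  rw [h2, mul_neg, neg_inj, mu, ← F.lamI_mul_lamI_opp i, star_mul]
  simp only [mul_assoc]
  rw [star_lamI_mul_cancel]

variable {F}

theorem mem_level_short {I : Ideal A} {G : AddSubgroup A} {i j : Idx n} (h : j ≠ i.opp) {a : A} :
    a ∈ F.level I G i j ↔ a ∈ I := by
  simp [level, h]

theorem mem_level_long {I : Ideal A} {G : AddSubgroup A} {i : Idx n} {a : A} :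
    a ∈ F.level I G i i.opp ↔ F.lamI i * a ∈ G := by
  simp only [level, if_true, lamPow_eq_star_lamI, Set.mem_ofPred_eq]
  constructor
  · rintro ⟨x, hx, rfl⟩
    rwa [lamI_mul_cancel]
  · intro h
    exact ⟨_, h, by rw [star_lamI_mul_cancel]⟩

end FormRing

namespace FormIdeal

variable {A : Type*} [Ring A] [StarRing A] {F : FormRing A} {n : ℕ} (P Q : FormIdeal F)

/-- The form ring `(A, Λ)` as a form ideal of itself. -/
def whole (F : FormRing A) : FormIdeal F where
  I := ⊤
  twoSided := inferInstance
  star_mem := fun _ _ => trivial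
  Gam := F.Lam
  min_le := by
    refine (AddSubgroup.closure_le _).2 ?_
    rintro _ (⟨a, _, rfl⟩ | ⟨a, _, c, hc, rfl⟩)
    · exact F.min_le a
    · exact F.conj_mem a c hc
  le_max := fun _ hx => ⟨trivial, hx⟩
  conj_mem := F.conj_mem

instance : P.I.IsTwoSided := P.twoSided

variable {P Q}

theorem mem_lev_short {i j : Idx n} (h : j ≠ i.opp) {a : A} : a ∈ P.lev i j ↔ a ∈ P.I :=
  FormRing.mem_level_short h

theorem mem_lev_long {i : Idx n} {a : A} : a ∈ P.lev i i.opp ↔ F.lamI i * a ∈ P.Gam :=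
  FormRing.mem_level_long

theorem Gam_le_Lam {x : A} (hx : x ∈ P.Gam) : x ∈ F.Lam := (P.le_max x hx).2

theorem lev_le_ideal {i j : Idx n} {a : A} (ha : a ∈ P.lev i j) : a ∈ P.I := by
  by_cases h : j = i.opp
  · subst h
    rw [mem_lev_long] at ha
    have := Ideal.mul_mem_left P.I (star (F.lamI i)) (P.le_max _ ha).1
    rwa [F.star_lamI_mul_cancel] at this
  · exact (mem_lev_short h).1 ha

theorem lev_le_whole {i j : Idx n} {a : A} (ha : a ∈ P.lev i j) : a ∈ (whole F).lev i j := by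
  by_cases h : j = i.opp
  · subst h
    rw [mem_lev_long] at ha ⊢
    exact Gam_le_Lam ha
  · exact (mem_lev_short h).2 trivial

theorem lev_add {i j : Idx n} {a b : A} (ha : a ∈ P.lev i j) (hb : b ∈ P.lev i j) :
    a + b ∈ P.lev i j := by
  by_cases h : j = i.opp
  · subst h
    rw [mem_lev_long] at *
    rw [mul_add]
    exact add_mem ha hb
  · rw [mem_lev_short h] at *
    exact add_mem ha hb

theorem lev_neg {i j : Idx n} {a : A} (ha : a ∈ P.lev i j) : -a ∈ P.lev i j := by
  by_cases h : j = i.opp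
  · subst h
    rw [mem_lev_long] at *
    rw [mul_neg]
    exact neg_mem ha
  · rw [mem_lev_short h] at *
    exact neg_mem ha

theorem lev_zero {i j : Idx n} : (0 : A) ∈ P.lev i j := by
  by_cases h : j = i.opp
  · subst h
    rw [mem_lev_long, mul_zero]
    exact zero_mem _
  · rw [mem_lev_short h]
    exact zero_mem _

theorem lev_opp {i j : Idx n} {a : A} (ha : a ∈ P.lev i j) :
    -(F.mu i j * star a) ∈ P.lev j.opp i.opp := by
  by_cases h : j = i.opp
  · subst h
    rw [Idx.opp_opp]
    rw [mem_lev_long] at *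
    rw [F.star_of_lamI_mul_mem (Gam_le_Lam ha), mul_neg (F.mu _ _), neg_neg,
      F.mu_mul_mu_assoc, F.mu_self, one_mul]
    exact ha
  · have h' : i.opp ≠ j.opp.opp := by
      rw [Idx.opp_opp]; exact fun e => h e.symm
    rw [mem_lev_short h] at ha
    rw [mem_lev_short h']
    exact neg_mem (Ideal.mul_mem_left _ _ (P.star_mem _ ha))

/-- The diagonal antisymmetrisation of an element of the ideal is an admissible long root
argument. -/
theorem sub_mu_star_mem_lev {i : Idx n} {a : A} (ha : a ∈ P.I) :
    a - F.mu i i.opp * star a ∈ P.lev i i.opp := by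
  rw [mem_lev_long]
  have h : F.lamI i * (a - F.mu i i.opp * star a)
      = F.lamI i * a - F.lam * star (F.lamI i * a) := by
    rw [mul_sub, ← mul_assoc, F.lamI_mul_mu, star_mul, ← F.star_lamI_central,
      ← F.lamI_mul_lamI_opp i, F.lamI_central i (F.lamI i.opp), mul_assoc (F.lamI i.opp),
      F.lamI_mul_cancel]
  rw [h]
  exact P.min_le (AddSubgroup.subset_closure (Or.inl ⟨_, Ideal.mul_mem_left _ _ ha, rfl⟩))

theorem circ_comm : P.circ Q = Q.circ P := by
  have h1 : circIdeal P Q = circIdeal Q P := sup_comm _ _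
  have h2 : circGam P Q = circGam Q P := by
    unfold circGam
    rw [h1, sup_assoc, sup_assoc, sup_comm (conjForm Q.I P.Gam)]
  unfold circ
  congr

theorem mul_mem_circ {a b : A} (ha : a ∈ P.I) (hb : b ∈ Q.I) : a * b ∈ (P.circ Q).I :=
  Ideal.mem_sup_left (Ideal.mul_mem_mul ha hb)

theorem mul_mem_circ' {a b : A} (ha : a ∈ P.I) (hb : b ∈ Q.I) : b * a ∈ (P.circ Q).I :=
  Ideal.mem_sup_right (Ideal.mul_mem_mul hb ha)

theorem conj_mem_lev_circ {i j : Idx n} {a b : A} (ha : a ∈ P.lev i i.opp) (hb : b ∈ Q.I) :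
    -(F.mu i.opp j * (star b * a * b)) ∈ (P.circ Q).lev j.opp j := by
  have h := mem_lev_long (P := P.circ Q) (i := j.opp) (a := -(F.mu i.opp j * (star b * a * b)))
  rw [Idx.opp_opp] at h
  rw [h, mul_neg, F.mu_opp_left, ← mul_assoc, F.lamI_mul_mu, mul_assoc, ← mul_assoc, F.lamI_central,
    mul_assoc _ (F.lamI i), ← mul_assoc (F.lamI i)]
  refine neg_mem ?_
  rw [mem_lev_long] at ha
  have := AddSubgroup.subset_closure (k := {y | ∃ b ∈ Q.I, ∃ x ∈ P.Gam, y = b * x * star b})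
    ⟨star b, Q.star_mem _ hb, _, ha, rfl⟩
  rw [star_star, mul_assoc] at this
  exact AddSubgroup.mem_sup_left (AddSubgroup.mem_sup_right this)

theorem circ_whole_lev {i j : Idx n} {a : A} (ha : a ∈ (P.circ (whole F)).lev i j) :
    a ∈ P.lev i j := by
  have h1 : circIdeal P (whole F) ≤ P.I := sup_le
    (Ideal.mul_le.2 fun a ha b _ => Ideal.mul_mem_right b _ ha)
    (Ideal.mul_le.2 fun a _ b hb => Ideal.mul_mem_left _ a hb)
  by_cases h : j = i.opp
  · subst h
    rw [mem_lev_long] at *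
    refine circGam_le P (whole F) P.Gam ?_ ?_ ?_ ?_ ha
    · exact fun a ha => P.min_le (AddSubgroup.subset_closure (Or.inl ⟨a, h1 ha, rfl⟩))
    · exact fun a ha c hc => P.min_le (AddSubgroup.subset_closure (Or.inr ⟨a, h1 ha, c, hc, rfl⟩))
    · exact fun b _ x hx => P.conj_mem b x hx
    · exact fun a ha c hc => P.min_le (AddSubgroup.subset_closure (Or.inr ⟨a, ha, c, hc, rfl⟩))
  · rw [mem_lev_short h] at *
    exact h1 ha

end FormIdeal

/-! ### Commutation relations between transvections -/

namespace FormRing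

variable {A : Type*} [Ring A] [StarRing A] (F : FormRing A) {n : ℕ}

open Matrix

theorem T_val_short {i j : Idx n} (hij : i ≠ j) (h : j ≠ i.opp) (a : A) :
    (F.T i j a).val = 1 + single i j a - single j.opp i.opp (F.mu i j * star a) := by
  simp [T, hij, tMat, h, lamPow_eq_mu]

theorem T_val_long (i : Idx n) (a : A) : (F.T i i.opp a).val = 1 + single i i.opp a := by
  simp [T, i.opp_ne.symm, tMat]

theorem T_neg {i j : Idx n} (hij : i ≠ j) (a : A) : F.T i j (-a) = (F.T i j a)⁻¹ := by
  rw [eq_inv_iff_mul_eq_one]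
  ext1
  have := F.tMat_mul_neg hij (-a)
  simp only [neg_neg] at this
  simpa [T, hij] using this

theorem T_add {i j : Idx n} (hij : i ≠ j) (a b : A) : F.T i j (a + b) = F.T i j a * F.T i j b := by
  ext1
  have hji : j ≠ i := hij.symm
  have ho : i.opp ≠ j.opp := fun h => hij (Idx.opp_inj.1 h)
  by_cases h : j = i.opp
  · subst h
    simp only [Units.val_mul, T_val_long, mul_add, add_mul, mul_one, one_mul,
      single_mul_single_of_ne _ _ _ _ hji, single_add]
    abel
  · simp only [Units.val_mul, F.T_val_short hij h, mul_add, add_mul, mul_sub, sub_mul, mul_one,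
      one_mul, single_mul_single_of_ne _ _ _ _ hji, single_mul_single_of_ne _ _ _ _ ho, star_add,
      single_mul_single_of_ne _ _ _ _ i.opp_ne, single_mul_single_of_ne _ _ _ _ j.opp_ne.symm,
      single_add]
    abel

theorem T_zero (i j : Idx n) : F.T i j 0 = 1 := by
  by_cases h : i = j
  · simp [T, h]
  · have := F.T_add h 0 0
    rwa [add_zero, left_eq_mul] at this

theorem T_opp {i j : Idx n} (hij : i ≠ j) {a : A} (ha : a ∈ F.level ⊤ F.Lam i j) :
    F.T j.opp i.opp (-(F.mu i j * star a)) = F.T i j a := by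
  ext1
  by_cases h : j = i.opp
  · subst h
    rw [Idx.opp_opp, T_val_long]
    rw [mem_level_long] at ha
    rw [F.star_of_lamI_mul_mem ha, mul_neg (F.mu _ _), neg_neg, F.mu_mul_mu_assoc, F.mu_self,
      one_mul, T_val_long]
  · have h' : i.opp ≠ j.opp.opp := by
      rw [Idx.opp_opp]; exact fun e => h e.symm
    have ho : j.opp ≠ i.opp := fun h => hij (Idx.opp_inj.1 h).symm
    rw [F.T_val_short hij h, F.T_val_short ho h']
    simp only [Idx.opp_opp, mu_opp, star_neg, star_mul, star_star, star_mu]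
    rw [← mu_central, mul_neg, mu_mul_mu_assoc, mu_self, one_mul, ← single_neg, ← single_neg]
    abel

/-- Transvections whose indices do not meet commute. -/
theorem T_comm {i j k l : Idx n} (hij : i ≠ j) (hkl : k ≠ l) (h1 : k ≠ j) (h2 : k ≠ i.opp)
    (h3 : l ≠ i) (h4 : l ≠ j.opp) (a b : A) : F.T i j a * F.T k l b = F.T k l b * F.T i j a := by
  have e1 : j.opp ≠ l := h4.symm
  have e3 : i.opp ≠ k := h2.symm
  have e4 : k.opp ≠ i := fun h => h2 (Idx.eq_opp_comm.1 h.symm)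
  have e5 : l.opp ≠ i.opp := fun h => h3 (Idx.opp_inj.1 h)
  have e6 : j ≠ l.opp := fun h => h4 (Idx.eq_opp_comm.1 h)
  have e7 : k.opp ≠ j.opp := fun h => h1 (Idx.opp_inj.1 h)
  ext1
  by_cases h : j = i.opp <;> by_cases h' : l = k.opp
  all_goals
    try subst h
    try subst h'
    simp only [Units.val_mul, F.T_val_long, F.T_val_short hij, F.T_val_short hkl, mul_add, add_mul,
      mul_sub, sub_mul, mul_one, one_mul, *, ne_eq, not_false_eq_true]
    simp only [single_mul_single_of_ne, ne_eq, not_false_eq_true, *, h1.symm, e1.symm, e5.symm]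
    abel


theorem mu_mul_mul_mu (i j k : Idx n) (x y : A) :
    F.mu j k * (x * (F.mu i j * y)) = F.mu i k * (x * y) := by
  rw [← mul_assoc x, ← mu_central, mul_assoc, ← mul_assoc, mu_central, mu_mul_mu]

theorem T_commutator_short {i j k : Idx n} (hij : i ≠ j) (hij' : j ≠ i.opp) (hjk : j ≠ k)
    (hjk' : k ≠ j.opp) (hik : i ≠ k) (hik' : k ≠ i.opp) (a b : A) :
    F.T i j a * F.T j k b * (F.T i j a)⁻¹ * (F.T j k b)⁻¹ = F.T i k (a * b) := by
  rw [mul_inv_eq_iff_eq_mul, mul_inv_eq_iff_eq_mul]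
  ext1
  have e1 : j.opp ≠ i.opp := fun h => hij (Idx.opp_inj.1 h).symm
  have e2 : j.opp ≠ k.opp := fun h => hjk (Idx.opp_inj.1 h)
  have e3 : i.opp ≠ k.opp := fun h => hik (Idx.opp_inj.1 h)
  have e4 : i.opp ≠ j := hij'.symm
  have e5 : j.opp ≠ k := hjk'.symm
  have e6 : i.opp ≠ k := hik'.symm
  have e7 : j.opp ≠ i := fun h => hij' (Idx.eq_opp_comm.1 h.symm)
  have e8 : k.opp ≠ j := fun h => hjk' (Idx.eq_opp_comm.1 h.symm)
  have e9 : k.opp ≠ i := fun h => hik' (Idx.eq_opp_comm.1 h.symm)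
  simp only [Units.val_mul, F.T_val_short hij hij', F.T_val_short hjk hjk', F.T_val_short hik hik',
    mul_add, add_mul, mul_sub, sub_mul, mul_one, one_mul]
  simp only [single_mul_single_of_ne, single_mul_single_same, ne_eq, not_false_eq_true, *,
    hjk.symm, hik.symm, e1.symm, e5.symm, e8.symm, k.opp_ne.symm, Idx.opp_ne,
    star_mul, mul_assoc, mu_mul_mul_mu, zero_mul]
  abel

theorem T_commutator_short_to_long {i j : Idx n} (hij : i ≠ j) (hij' : j ≠ i.opp) (a b : A) :
    F.T i j a * F.T j i.opp b * (F.T i j a)⁻¹ * (F.T j i.opp b)⁻¹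
      = F.T i i.opp (a * b - F.mu i i.opp * star (a * b)) := by
  rw [mul_inv_eq_iff_eq_mul, mul_inv_eq_iff_eq_mul]
  ext1
  have e1 : j.opp ≠ i.opp := fun h => hij (Idx.opp_inj.1 h).symm
  have e7 : j.opp ≠ i := fun h => hij' (Idx.eq_opp_comm.1 h.symm)
  have e0 : i.opp ≠ j.opp := e1.symm
  have e2 : (F.T i i.opp (a * b - F.mu i i.opp * star (a * b))).val
      = 1 + single i i.opp (a * b) - single i i.opp (F.mu i i.opp * (star b * star a)) := by
    rw [T_val_long, star_mul, sub_eq_add_neg, single_add, ← single_neg, add_sub_assoc,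
      sub_eq_add_neg]
  simp only [Units.val_mul, F.T_val_short hij hij', F.T_val_short hij' e0, e2,
    mul_add, add_mul, mul_sub, sub_mul, mul_one, one_mul, Idx.opp_opp]
  simp only [single_mul_single_of_ne, single_mul_single_same, ne_eq, not_false_eq_true, *,
    hij.symm, hij'.symm, e1.symm, i.opp_ne, mul_assoc, mu_mul_mul_mu]
  abel

/-- The commutator of a long and a short root transvection. -/
theorem T_commutator_long {i j : Idx n} (hij : i ≠ j) (hij' : j ≠ i.opp) {a : A}
    (ha : a ∈ F.level ⊤ F.Lam i i.opp) (b : A) :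
    F.T i i.opp a * F.T i.opp j b * (F.T i i.opp a)⁻¹ * (F.T i.opp j b)⁻¹
      = F.T i j (a * b) * F.T j.opp j (-(F.mu i.opp j * (star b * a * b))) := by
  rw [mul_inv_eq_iff_eq_mul, mul_inv_eq_iff_eq_mul]
  ext1
  have e1 : j.opp ≠ i.opp := fun h => hij (Idx.opp_inj.1 h).symm
  have e7 : j.opp ≠ i := fun h => hij' (Idx.eq_opp_comm.1 h.symm)
  have e0 : j ≠ i.opp.opp := by rw [i.opp_opp]; exact hij.symm
  have e2 := F.T_val_long j.opp (-(F.mu i.opp j * (star b * a * b)))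
  rw [Idx.opp_opp] at e2
  rw [mem_level_long] at ha
  have e3 : F.mu i j * (star b * star a) = -(F.mu i.opp j * (star b * a)) := by
    rw [F.star_of_lamI_mul_mem ha, mul_neg, mul_neg, mu_mul_mul_mu]
  simp only [Units.val_mul, F.T_val_short hij hij', F.T_val_short hij'.symm e0, F.T_val_long, e2,
    mul_add, add_mul, mul_sub, sub_mul, mul_one, one_mul, Idx.opp_opp]
  simp only [single_mul_single_of_ne, single_mul_single_same, ne_eq, not_false_eq_true, *,
    hij.symm, e1.symm, Idx.opp_ne, j.opp_ne.symm,
    star_mul, mul_assoc, ← single_neg, neg_mul, mul_neg, zero_mul]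
  abel

end FormRing

/-! ### Root vectors and root subgroups -/

namespace Idx

variable {n : ℕ}

/-- The weight `e_i` of the index `i`, with `e_{-i} = -e_i`. -/
def vec : Idx n → (Fin n → ℤ)
  | Sum.inl a => Pi.single a 1
  | Sum.inr a => -Pi.single a 1

/-- The coordinate functional dual to `vec`. -/
def coord : Idx n → ((Fin n → ℤ) →+ ℤ)
  | Sum.inl a => Pi.evalAddMonoidHom _ a
  | Sum.inr a => -Pi.evalAddMonoidHom _ a

/-- The root `e_i - e_j` of the transvection `T_ij`, in the root system of type `C_n`. -/
def root (i j : Idx n) : Fin n → ℤ := i.vec - j.vec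

theorem vec_opp (i : Idx n) : i.opp.vec = -i.vec := by
  cases i <;> simp [vec, opp]

theorem coord_vec (i j : Idx n) :
    i.coord j.vec = if j = i then 1 else if j = i.opp then -1 else 0 := by
  cases i <;> cases j <;> simp [vec, coord, opp, Pi.single_apply, eq_comm, neg_ite]

theorem coord_vec_self (i : Idx n) : i.coord i.vec = 1 := by simp [coord_vec]

theorem coord_root (p i j : Idx n) : p.coord (root i j) = p.coord i.vec - p.coord j.vec :=
  map_sub _ _ _

theorem neg_root (i j : Idx n) : -root i j = root j i := neg_sub _ _

theorem root_opp (i j : Idx n) : root j.opp i.opp = root i j := by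
  simp only [root, vec_opp]; abel

theorem vec_injective {i j : Idx n} (h : i.vec = j.vec) : i = j := by
  have h1 := coord_vec i j
  rw [← h, coord_vec_self] at h1
  split_ifs at h1 with h2 h2
  · exact h2.symm
  · omega

theorem root_eq_root {i j k l : Idx n} (hij : i ≠ j) (h : root k l = root i j) :
    k = i ∧ l = j ∨ k = j.opp ∧ l = i.opp := by
  have h1 := congrArg i.coord h
  rw [coord_root, coord_root, coord_vec_self] at h1
  have h2 : k = i ∨ l = i.opp := by
    by_contra hc
    rw [not_or] at hc
    simp only [coord_vec, hc.1, hc.2, hij.symm, if_false] at h1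
    split_ifs at h1 <;> omega
  rcases h2 with rfl | rfl
  · exact Or.inl ⟨rfl, vec_injective (sub_right_injective h)⟩
  · refine Or.inr ⟨vec_injective ?_, rfl⟩
    rw [← root_opp i j] at h
    exact sub_left_injective h

/-- Two roots that are not proportional are separated by a linear functional which vanishes on the
first one. -/
theorem exists_functional {i j k l : Idx n} (hij : i ≠ j) (hkl : k ≠ l) (h1 : root k l ≠ root i j)
    (h2 : root k l ≠ -root i j) :
    ∃ φ : (Fin n → ℤ) →+ ℤ, φ (root i j) = 0 ∧ 0 < φ (root k l) := by
  by_cases hk : k ≠ i ∧ k ≠ i.opp ∧ k ≠ j ∧ k ≠ j.opp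
  · refine ⟨k.coord, ?_, ?_⟩
    · have e1 : i ≠ k.opp := fun h => hk.2.1 (eq_opp_comm.1 h)
      have e2 : j ≠ k.opp := fun h => hk.2.2.2 (eq_opp_comm.1 h)
      simp [coord_root, coord_vec, hk.1.symm, hk.2.2.1.symm, e1, e2]
    · rw [coord_root, coord_vec_self, coord_vec, if_neg hkl.symm]
      split_ifs <;> norm_num
  by_cases hl : l ≠ i ∧ l ≠ i.opp ∧ l ≠ j ∧ l ≠ j.opp
  · refine ⟨-l.coord, ?_, ?_⟩
    · have e1 : i ≠ l.opp := fun h => hl.2.1 (eq_opp_comm.1 h)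
      have e2 : j ≠ l.opp := fun h => hl.2.2.2 (eq_opp_comm.1 h)
      simp [coord_root, coord_vec, hl.1.symm, hl.2.2.1.symm, e1, e2]
    · rw [AddMonoidHom.neg_apply, coord_root, coord_vec_self, coord_vec, if_neg hkl]
      split_ifs <;> norm_num
  have hi := i.opp_ne
  have hj := j.opp_ne
  -- Now both roots involve the same two coordinates.
  have key : ∃ φ : (Fin n → ℤ) →+ ℤ, φ (root i j) = 0 ∧ φ (root k l) ≠ 0 := by
    have hk' : k = i ∨ k = i.opp ∨ k = j ∨ k = j.opp := by tauto
    have hl' : l = i ∨ l = i.opp ∨ l = j ∨ l = j.opp := by tauto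
    by_cases hlong : j = i.opp
    · subst hlong
      exfalso
      rw [neg_root] at h2
      rw [opp_opp] at hk' hl'
      rcases hk' with rfl | rfl | rfl | rfl <;> rcases hl' with rfl | rfl | rfl | rfl <;> tauto
    · refine ⟨i.coord + j.coord, ?_, ?_⟩
      · have e1 : i ≠ j.opp := fun h => hlong (eq_opp_comm.1 h)
        simp [coord_root, coord_vec, hij, hij.symm, e1, hlong]
      · have e1 : i ≠ j.opp := fun h => hlong (eq_opp_comm.1 h)
        have e2 : j.opp ≠ i.opp := fun h => hij (opp_inj.1 h).symm
        have h3 := root_opp i j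
        have h4 := root_opp j i
        rw [neg_root] at h2
        rcases hk' with rfl | rfl | rfl | rfl <;> rcases hl' with rfl | rfl | rfl | rfl <;>
          first
          | exact absurd rfl hkl
          | exact absurd rfl h1
          | exact absurd rfl h2
          | exact absurd h3 h1
          | exact absurd h4 h2
          | simp [coord_root, coord_vec, vec_opp, hij, hij.symm, e1, hlong]
  obtain ⟨φ, h3, h4⟩ := key
  rcases lt_or_gt_of_ne h4 with h | h
  · exact ⟨-φ, by simp [h3], by simpa using h⟩
  · exact ⟨φ, h3, h⟩

end Idx

namespace FormIdeal

open Idx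
open scoped commutatorElement

variable {A : Type*} [Ring A] [StarRing A] {F : FormRing A} {n : ℕ} (P Q : FormIdeal F)

/-- The root subgroup of level `P` for the root `v`, consisting of the `T_ij(a)`, `a ∈ P`, with
`e_i - e_j = v`. It is trivial if `v` is not a root. -/
def rootGroup (v : Fin n → ℤ) : Subgroup (Matrix (Idx n) (Idx n) A)ˣ :=
  Subgroup.closure {g | ∃ i j : Idx n, i ≠ j ∧ root i j = v ∧ ∃ a ∈ P.lev i j, g = F.T i j a}

variable {P Q}

theorem T_mem_rootGroup {i j : Idx n} (hij : i ≠ j) {a : A} (ha : a ∈ P.lev i j) :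
    F.T i j a ∈ P.rootGroup (root i j) :=
  Subgroup.subset_closure ⟨i, j, hij, rfl, a, ha, rfl⟩

/-- Every element of a root subgroup is a single transvection, in either of its two forms. -/
theorem exists_T_of_mem_rootGroup {i j : Idx n} (hij : i ≠ j) {g : (Matrix (Idx n) (Idx n) A)ˣ}
    (hg : g ∈ P.rootGroup (root i j)) : ∃ a ∈ P.lev i j, g = F.T i j a := by
  induction hg using Subgroup.closure_induction with
  | mem g hg =>
    obtain ⟨k, l, hkl, h, a, ha, rfl⟩ := hg
    rcases root_eq_root hij h with ⟨rfl, rfl⟩ | ⟨rfl, rfl⟩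
    · exact ⟨a, ha, rfl⟩
    · refine ⟨_, by simpa only [opp_opp] using lev_opp ha, ?_⟩
      have := F.T_opp hkl (lev_le_whole ha)
      simpa only [opp_opp] using this.symm
  | one => exact ⟨0, lev_zero, (F.T_zero i j).symm⟩
  | mul x y _ _ hx hy =>
    obtain ⟨a, ha, rfl⟩ := hx
    obtain ⟨b, hb, rfl⟩ := hy
    exact ⟨a + b, lev_add ha hb, (F.T_add hij a b).symm⟩
  | inv x _ hx =>
    obtain ⟨a, ha, rfl⟩ := hx
    exact ⟨-a, lev_neg ha, (F.T_neg hij a).symm⟩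

/-- An element of a root subgroup is trivial or a transvection. -/
theorem eq_one_or_exists_T {v : Fin n → ℤ} {g : (Matrix (Idx n) (Idx n) A)ˣ}
    (hg : g ∈ P.rootGroup v) :
    g = 1 ∨ ∃ i j : Idx n, i ≠ j ∧ root i j = v ∧ ∃ a ∈ P.lev i j, g = F.T i j a := by
  by_cases hv : ∃ i j : Idx n, i ≠ j ∧ root i j = v
  · obtain ⟨i, j, hij, rfl⟩ := hv
    exact Or.inr ⟨i, j, hij, rfl, exists_T_of_mem_rootGroup hij hg⟩
  · left
    induction hg using Subgroup.closure_induction with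
    | mem g hg =>
      obtain ⟨k, l, hkl, h, _⟩ := hg
      exact absurd ⟨k, l, hkl, h⟩ hv
    | one => rfl
    | mul x y _ _ hx hy => rw [hx, hy, one_mul]
    | inv x _ hx => rw [hx, inv_one]

theorem rootGroup_mono (h : ∀ i j : Idx n, ∀ a ∈ P.lev i j, a ∈ Q.lev i j) (v : Fin n → ℤ) :
    P.rootGroup v ≤ Q.rootGroup v := by
  refine Subgroup.closure_mono ?_
  rintro g ⟨i, j, hij, hv, a, ha, rfl⟩
  exact ⟨i, j, hij, hv, a, h i j a ha, rfl⟩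

theorem rootGroup_le_whole (v : Fin n → ℤ) : P.rootGroup v ≤ (whole F).rootGroup v :=
  rootGroup_mono (fun _ _ _ => lev_le_whole) v

theorem rootGroup_circ_whole_le (v : Fin n → ℤ) :
    (P.circ (whole F)).rootGroup v ≤ P.rootGroup v :=
  rootGroup_mono (fun _ _ _ => circ_whole_lev) v

theorem rootGroup_le_FU (v : Fin n → ℤ) : P.rootGroup v ≤ P.FU n := by
  refine Subgroup.closure_mono ?_
  rintro g ⟨i, j, hij, _, a, ha, rfl⟩
  exact ⟨i, j, hij, a, ha, rfl⟩

theorem FU_le_of_rootGroup_le {N : Subgroup (Matrix (Idx n) (Idx n) A)ˣ}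
    (h : ∀ v : Fin n → ℤ, P.rootGroup v ≤ N) : P.FU n ≤ N := by
  refine (Subgroup.closure_le _).2 ?_
  rintro g ⟨i, j, hij, a, ha, rfl⟩
  exact h _ (T_mem_rootGroup hij ha)

/-- The commutator of two adjacent transvections `T_ij`, `T_jl` lies in the group generated by the
positive combinations of the two roots. -/
theorem commutator_T_adjacent {i j l : Idx n} (hij : i ≠ j) (hjl : j ≠ l) (hil : l ≠ i)
    {a b : A} (ha : a ∈ P.lev i j) (hb : b ∈ Q.lev j l)
    {N : Subgroup (Matrix (Idx n) (Idx n) A)ˣ}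
    (hN : ∀ p q : ℕ, 0 < p → 0 < q →
      (P.circ Q).rootGroup (p • root i j + q • root j l) ≤ N) :
    ⁅F.T i j a, F.T j l b⁆ ∈ N := by
  have h11 : (P.circ Q).rootGroup (root i l) ≤ N := by
    have := hN 1 1 one_pos one_pos
    rwa [one_smul, one_smul, root, root, sub_add_sub_cancel] at this
  rw [commutatorElement_def]
  by_cases hij' : j = i.opp
  · subst hij'
    have hlo : l ≠ i.opp := hjl.symm
    rw [F.T_commutator_long hil.symm hlo (lev_le_whole ha)]
    have hb' := (mem_lev_short (P := Q) (i := i.opp) (j := l) (by rwa [opp_opp])).1 hb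
    refine mul_mem (h11 (T_mem_rootGroup hil.symm ?_)) ?_
    · rw [mem_lev_short hlo]
      exact mul_mem_circ (lev_le_ideal ha) hb'
    · have h12 := hN 1 2 one_pos two_pos
      have e : 1 • root i i.opp + 2 • root i.opp l = root l.opp l := by
        simp only [root, vec_opp, one_smul, two_smul]; abel
      rw [e] at h12
      exact h12 (T_mem_rootGroup l.opp_ne (conj_mem_lev_circ ha hb'))
  by_cases hjl' : l = j.opp
  · subst hjl'
    -- Replacing `T_ij` by its second form `T_{-j,-i}` reduces this to a long root in first place.
    rw [← F.T_opp hij (lev_le_whole ha), ← commutatorElement_def, ← inv_mem_iff,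
      commutatorElement_inv, commutatorElement_def]
    have e4 : i.opp ≠ j.opp := fun h => hij (opp_inj.1 h)
    have ha' := lev_le_ideal (lev_opp ha)
    rw [F.T_commutator_long hij' e4 (lev_le_whole hb)]
    have hs : root j i.opp = root i j.opp := by rw [← root_opp, opp_opp]
    rw [circ_comm] at h11 hN
    refine mul_mem ?_ ?_
    · rw [← hs] at h11
      refine h11 (T_mem_rootGroup hij' ?_)
      rw [mem_lev_short e4]
      exact mul_mem_circ (lev_le_ideal hb) ha'
    · have h21 := hN 2 1 two_pos one_pos
      have e : 2 • root i j + 1 • root j j.opp = root i.opp.opp i.opp := by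
        simp only [root, vec_opp, one_smul, two_smul]; abel
      rw [e] at h21
      exact h21 (T_mem_rootGroup i.opp.opp_ne (conj_mem_lev_circ hb ha'))
  rw [mem_lev_short hij'] at ha
  rw [mem_lev_short hjl'] at hb
  by_cases hil' : l = i.opp
  · subst hil'
    rw [F.T_commutator_short_to_long hij hij']
    exact h11 (T_mem_rootGroup i.opp_ne.symm (sub_mu_star_mem_lev (mul_mem_circ ha hb)))
  · rw [F.T_commutator_short hij hij' hjl hjl' hil.symm hil']
    refine h11 (T_mem_rootGroup hil.symm ?_)
    rw [mem_lev_short hil']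
    exact mul_mem_circ ha hb

/-- The Chevalley commutator formula: for `v + w ≠ 0`, commutators of the root subgroups for `v` and
`w` lie in the group generated by the root subgroups for `p v + q w`, `p, q ≥ 1`, at the level of
the symmetrised product. -/
theorem commutator_mem_of_add_ne_zero {v w : Fin n → ℤ} (hvw : v + w ≠ 0)
    {x y : (Matrix (Idx n) (Idx n) A)ˣ} (hx : x ∈ P.rootGroup v) (hy : y ∈ Q.rootGroup w)
    {N : Subgroup (Matrix (Idx n) (Idx n) A)ˣ}
    (hN : ∀ p q : ℕ, 0 < p → 0 < q → (P.circ Q).rootGroup (p • v + q • w) ≤ N) :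
    ⁅x, y⁆ ∈ N := by
  rcases eq_one_or_exists_T hx with rfl | ⟨i, j, hij, rfl, a, ha, rfl⟩
  · simp
  rcases eq_one_or_exists_T hy with rfl | ⟨k, l, hkl, rfl, b, hb, rfl⟩
  · simp
  have adj : ∀ i j k l : Idx n, i ≠ j → k ≠ l → ∀ a ∈ P.lev i j, ∀ b ∈ Q.lev k l,
      root i j + root k l ≠ 0 → (∀ p q : ℕ, 0 < p → 0 < q →
        (P.circ Q).rootGroup (p • root i j + q • root k l) ≤ N) →
      k = j → ⁅F.T i j a, F.T k l b⁆ ∈ N := by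
    rintro i j k l hij hkl a ha b hb hvw hN rfl
    refine commutator_T_adjacent hij hkl ?_ ha hb hN
    rintro rfl
    exact hvw (by rw [← neg_root, neg_add_cancel])
  by_cases h1 : k = j
  · exact adj i j k l hij hkl a ha b hb hvw hN h1
  have hij' : j.opp ≠ i.opp := fun h => hij (opp_inj.1 h).symm
  have hkl' : l.opp ≠ k.opp := fun h => hkl (opp_inj.1 h).symm
  by_cases h2 : k = i.opp
  · rw [← F.T_opp hij (lev_le_whole ha)]
    refine adj _ _ _ _ hij' hkl _ (lev_opp ha) b hb ?_ ?_ h2 <;> rwa [root_opp]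
  by_cases h3 : l = i
  · rw [← F.T_opp hij (lev_le_whole ha), ← F.T_opp hkl (lev_le_whole hb)]
    refine adj _ _ _ _ hij' hkl' _ (lev_opp ha) _ (lev_opp hb) ?_ ?_ (by rw [h3]) <;>
      rwa [root_opp, root_opp]
  by_cases h4 : l = j.opp
  · rw [← F.T_opp hkl (lev_le_whole hb)]
    refine adj _ _ _ _ hij hkl' _ ha _ (lev_opp hb) ?_ ?_ (by rw [h4, opp_opp]) <;> rwa [root_opp]
  · rw [commutatorElement_eq_one_iff_mul_comm.2 (F.T_comm hij hkl h1 h2 h3 h4 a b)]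
    exact one_mem N

end FormIdeal

/-! ### Commuting modulo a normalised subgroup -/

section CommMod

open scoped commutatorElement

variable {G : Type*} [Group G]

theorem Subgroup.conj_mem_of_mem_normalizer {H : Subgroup G} {g x : G}
    (hg : g ∈ Subgroup.normalizer (H : Set G)) (hx : x ∈ H) : g * x * g⁻¹ ∈ H :=
  (Subgroup.mem_normalizer_iff.1 hg x).1 hx

theorem Subgroup.conj_mem_of_mem_normalizer' {H : Subgroup G} {g x : G}
    (hg : g ∈ Subgroup.normalizer (H : Set G)) (hx : x ∈ H) : g⁻¹ * x * g ∈ H := by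
  simpa using Subgroup.conj_mem_of_mem_normalizer (inv_mem hg) hx

theorem Subgroup.le_normalizer_of_conj_mem {U N : Subgroup G}
    (h : ∀ z ∈ U, ∀ g ∈ N, z * g * z⁻¹ ∈ N) : U ≤ Subgroup.normalizer (N : Set G) := by
  intro z hz
  refine Subgroup.mem_normalizer_iff.2 fun g => ⟨h z hz g, fun hg => ?_⟩
  have := h _ (inv_mem hz) _ hg
  simpa [mul_assoc] using this

/-- It is enough to conjugate generators. -/
theorem Subgroup.le_normalizer_closure {U : Subgroup G} {X : Set G}
    (h : ∀ z ∈ U, ∀ g ∈ X, z * g * z⁻¹ ∈ Subgroup.closure X) :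
    U ≤ Subgroup.normalizer (Subgroup.closure X : Set G) := by
  refine Subgroup.le_normalizer_of_conj_mem fun z hz g hg => ?_
  induction hg using Subgroup.closure_induction with
  | mem g hg => exact h z hz g hg
  | one => simp
  | mul a b _ _ ha hb =>
    have := mul_mem ha hb
    rwa [conj_mul] at this
  | inv a _ ha =>
    have := inv_mem ha
    rwa [conj_inv] at this

/-- The centraliser of `X` modulo `H`, inside the normaliser of `H`. -/
def centMod (H : Subgroup G) (X : Set G) : Subgroup G where
  carrier := {g | g ∈ Subgroup.normalizer (H : Set G) ∧ ∀ x ∈ X, ⁅g, x⁆ ∈ H}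
  one_mem' := ⟨one_mem _, fun x _ => by simp⟩
  mul_mem' := by
    rintro a b ⟨ha, ha'⟩ ⟨hb, hb'⟩
    refine ⟨mul_mem ha hb, fun x hx => ?_⟩
    have := mul_mem (Subgroup.conj_mem_of_mem_normalizer ha (hb' x hx)) (ha' x hx)
    convert this using 1
    simp only [commutatorElement_def]
    group
  inv_mem' := by
    rintro a ⟨ha, ha'⟩
    refine ⟨inv_mem ha, fun x hx => ?_⟩
    have := Subgroup.conj_mem_of_mem_normalizer' ha (inv_mem (ha' x hx))
    convert this using 1
    simp only [commutatorElement_def]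
    group

variable {H : Subgroup G} {X : Set G}

theorem commutator_mem_comm {x y : G} : ⁅x, y⁆ ∈ H ↔ ⁅y, x⁆ ∈ H := by
  rw [← inv_mem_iff, commutatorElement_inv]

theorem conj_eq_commutator_mul (x y : G) : x * y * x⁻¹ = ⁅x, y⁆ * y := by
  rw [commutatorElement_def]; group

/-- Commuting modulo `H` is unchanged by conjugation in the normaliser of `H`. -/
theorem commutator_conj_mem {g x y : G} (hg : g ∈ Subgroup.normalizer (H : Set G)) :
    ⁅g * x * g⁻¹, y⁆ ∈ H ↔ ⁅x, g⁻¹ * y * g⁆ ∈ H := by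
  rw [Subgroup.mem_normalizer_iff.1 hg ⁅x, _⁆]
  have : ⁅g * x * g⁻¹, y⁆ = g * ⁅x, g⁻¹ * y * g⁆ * g⁻¹ := by
    simp only [commutatorElement_def]
    group
  rw [this]

theorem commutator_conj_mem' {g x y : G} (hg : g ∈ Subgroup.normalizer (H : Set G)) :
    ⁅x, g * y * g⁻¹⁆ ∈ H ↔ ⁅g⁻¹ * x * g, y⁆ ∈ H := by
  rw [commutator_mem_comm, commutator_conj_mem hg, commutator_mem_comm]

theorem commutator_mem_of_mem_closure {Y : Set G}
    (hY : Y ⊆ Subgroup.normalizer (H : Set G)) {x y : G} (h : ∀ y ∈ Y, ⁅x, y⁆ ∈ H)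
    (hy : y ∈ Subgroup.closure Y) : ⁅x, y⁆ ∈ H := by
  have : Subgroup.closure Y ≤ centMod H {x} := by
    refine (Subgroup.closure_le _).2 fun y hy => ⟨hY hy, ?_⟩
    rintro _ rfl
    exact commutator_mem_comm.1 (h y hy)
  exact commutator_mem_comm.1 ((this hy).2 x rfl)

theorem normalizer_le_normalizer_centMod {N : Subgroup G} {z : G}
    (hz : z ∈ Subgroup.normalizer (H : Set G)) (hz' : z ∈ Subgroup.normalizer (N : Set G)) :
    z ∈ Subgroup.normalizer (centMod H (N : Set G) : Set G) := by
  have key : Subgroup.normalizer (H : Set G) ⊓ Subgroup.normalizer (N : Set G)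
      ≤ Subgroup.normalizer (centMod H (N : Set G) : Set G) := by
    refine Subgroup.le_normalizer_of_conj_mem ?_
    rintro z ⟨hz, hz'⟩ g ⟨hg, hg'⟩
    refine ⟨mul_mem (mul_mem hz hg) (inv_mem hz), fun x hx => ?_⟩
    rw [commutator_conj_mem hz]
    exact hg' _ (Subgroup.conj_mem_of_mem_normalizer' hz' hx)
  exact key ⟨hz, hz'⟩

end CommMod

/-! ### Generation of the relative elementary group by elementary conjugates -/

namespace FormIdeal

open Idx
open scoped commutatorElement

variable {A : Type*} [Ring A] [StarRing A] {F : FormRing A} {n : ℕ} (P Q : FormIdeal F)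

/-- The subgroup generated by the root subgroups on which the functional `φ` is positive. -/
def upper (φ : (Fin n → ℤ) →+ ℤ) : Subgroup (Matrix (Idx n) (Idx n) A)ˣ :=
  Subgroup.closure {g | ∃ v, 0 < φ v ∧ g ∈ P.rootGroup v}

/-- The elementary conjugates of level `P` for the root `v`. -/
def conjSet (v : Fin n → ℤ) : Set (Matrix (Idx n) (Idx n) A)ˣ :=
  {g | ∃ t ∈ (whole F).rootGroup (-v), ∃ y ∈ P.rootGroup v, g = t * y * t⁻¹}

/-- The subgroup generated by all root subgroups of level `P` and the elementary conjugates for the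
roots in `S`. -/
def genConj (S : Set (Fin n → ℤ)) : Subgroup (Matrix (Idx n) (Idx n) A)ˣ :=
  Subgroup.closure ({g | ∃ v : Fin n → ℤ, g ∈ P.rootGroup v} ∪ {g | ∃ v ∈ S, g ∈ P.conjSet v})

variable {P Q}

theorem rootGroup_le_absEU (v : Fin n → ℤ) : (whole F).rootGroup v ≤ F.absEU n :=
  rootGroup_le_FU v

theorem rootGroup_le_upper {φ : (Fin n → ℤ) →+ ℤ} {v : Fin n → ℤ} (hv : 0 < φ v) :
    P.rootGroup v ≤ P.upper φ :=
  fun _ hg => Subgroup.subset_closure ⟨v, hv, hg⟩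

theorem upper_le_FU (φ : (Fin n → ℤ) →+ ℤ) : P.upper φ ≤ P.FU n :=
  (Subgroup.closure_le _).2 fun _ ⟨v, _, hg⟩ => rootGroup_le_FU v hg

theorem rootGroup_le_genConj (S : Set (Fin n → ℤ)) (v : Fin n → ℤ) :
    P.rootGroup v ≤ P.genConj S :=
  fun _ hg => Subgroup.subset_closure (Or.inl ⟨v, hg⟩)

theorem conjSet_subset_genConj {S : Set (Fin n → ℤ)} {v : Fin n → ℤ} (hv : v ∈ S) :
    P.conjSet v ⊆ P.genConj S :=
  fun _ hg => Subgroup.subset_closure (Or.inr ⟨v, hv, hg⟩)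

theorem genConj_mono {S S' : Set (Fin n → ℤ)} (h : S ⊆ S') :
    (P.genConj S : Subgroup (Matrix (Idx n) (Idx n) A)ˣ) ≤ P.genConj S' :=
  Subgroup.closure_mono (Set.union_subset_union_right _ fun _ ⟨v, hv, hg⟩ => ⟨v, h hv, hg⟩)

theorem FU_le_genConj (S : Set (Fin n → ℤ)) : P.FU n ≤ P.genConj S :=
  FU_le_of_rootGroup_le fun v => rootGroup_le_genConj S v

/-- A relative root subgroup commutes with an absolute one, not for the opposite root, modulo root
subgroups of the same relative level. -/
theorem commutator_whole_mem {v w : Fin n → ℤ} (hvw : v + w ≠ 0)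
    {x y : (Matrix (Idx n) (Idx n) A)ˣ} (hx : x ∈ (whole F).rootGroup v) (hy : y ∈ P.rootGroup w)
    {N : Subgroup (Matrix (Idx n) (Idx n) A)ˣ}
    (hN : ∀ p q : ℕ, 0 < p → 0 < q → P.rootGroup (p • v + q • w) ≤ N) : ⁅x, y⁆ ∈ N := by
  refine commutator_mem_of_add_ne_zero hvw hx hy fun p q hp hq => ?_
  rw [circ_comm]
  exact (rootGroup_circ_whole_le _).trans (hN p q hp hq)

theorem conj_mem_FU {v w : Fin n → ℤ} (hvw : v + w ≠ 0)
    {x y : (Matrix (Idx n) (Idx n) A)ˣ} (hx : x ∈ (whole F).rootGroup v)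
    (hy : y ∈ P.rootGroup w) : x * y * x⁻¹ ∈ P.FU n := by
  rw [conj_eq_commutator_mul]
  exact mul_mem (commutator_whole_mem hvw hx hy fun _ _ _ _ => rootGroup_le_FU _)
    (rootGroup_le_FU _ hy)

theorem apply_comb_pos {φ : (Fin n → ℤ) →+ ℤ} {v w : Fin n → ℤ} (hv : 0 ≤ φ v) (hw : 0 < φ w)
    {p q : ℕ} (hq : 0 < q) : 0 < φ (p • v + q • w) := by
  rw [map_add, map_nsmul, map_nsmul]
  have : 0 < q • φ w := nsmul_pos hw hq.ne'
  have : 0 ≤ p • φ v := nsmul_nonneg hv p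
  omega

theorem add_ne_zero_of_apply_pos {φ : (Fin n → ℤ) →+ ℤ} {v w : Fin n → ℤ} (h : 0 < φ v + φ w) :
    v + w ≠ 0 := by
  intro h0
  rw [← map_add, h0, map_zero] at h
  exact h.false

theorem rootGroup_le_normalizer_upper {φ : (Fin n → ℤ) →+ ℤ} {w : Fin n → ℤ} (hw : 0 ≤ φ w) :
    (whole F).rootGroup w ≤ Subgroup.normalizer (P.upper φ : Set (Matrix (Idx n) (Idx n) A)ˣ) := by
  refine Subgroup.le_normalizer_closure ?_
  rintro z hz g ⟨v, hv, hg⟩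
  rw [conj_eq_commutator_mul]
  refine mul_mem (commutator_whole_mem (add_ne_zero_of_apply_pos (φ := φ) (by omega)) hz hg
    fun p q _ hq => ?_) (Subgroup.subset_closure ⟨v, hv, hg⟩)
  exact rootGroup_le_upper (apply_comb_pos hw hv hq)

/-- The elementary conjugates for a root `v` act trivially on the unipotent radical of a parabolic
subgroup whose Levi subgroup contains `v`, modulo the relative unipotent radical. -/
theorem commutator_conj_upper_mem {φ : (Fin n → ℤ) →+ ℤ} {v : Fin n → ℤ} (hv : φ v = 0)
    {g z : (Matrix (Idx n) (Idx n) A)ˣ} (hg : g ∈ P.conjSet v) (hz : z ∈ (whole F).upper φ) :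
    ⁅g, z⁆ ∈ P.upper φ := by
  obtain ⟨t, ht, y, hy, rfl⟩ := hg
  have hv' : 0 ≤ φ (-v) := by rw [map_neg, hv, neg_zero]
  rw [commutator_conj_mem (rootGroup_le_normalizer_upper hv' ht)]
  refine commutator_mem_of_mem_closure (Y := {g | ∃ v, 0 < φ v ∧ g ∈ (whole F).rootGroup v})
    (fun z ⟨w, hw, hz⟩ => rootGroup_le_normalizer_upper hw.le hz) ?_
    (Subgroup.conj_mem_of_mem_normalizer' (rootGroup_le_normalizer_upper hv' ht) hz)
  rintro z ⟨w, hw, hz⟩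
  rw [commutator_mem_comm]
  refine commutator_whole_mem (add_ne_zero_of_apply_pos (φ := φ) (by omega)) hz hy
    fun p q hp _ => ?_
  rw [add_comm]
  exact rootGroup_le_upper (apply_comb_pos hv.ge hw hp)

theorem exists_functional_of_mem {v w : Fin n → ℤ} {x y : (Matrix (Idx n) (Idx n) A)ˣ}
    (hx : x ∈ P.rootGroup v) (hy : y ∈ Q.rootGroup w) (h1 : w ≠ v) (h2 : w ≠ -v) :
    x = 1 ∨ y = 1 ∨ ∃ φ : (Fin n → ℤ) →+ ℤ, φ v = 0 ∧ 0 < φ w := by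
  rcases eq_one_or_exists_T hx with h | ⟨i, j, hij, rfl, -⟩
  · exact Or.inl h
  rcases eq_one_or_exists_T hy with h | ⟨k, l, hkl, rfl, -⟩
  · exact Or.inr (Or.inl h)
  exact Or.inr (Or.inr (exists_functional hij hkl h1 h2))

/-- Conjugation by the root subgroup for `w` adds at most the elementary conjugates for `-w` to
`genConj S`, provided that `S` has none for `w` itself. -/
theorem conj_mem_genConj {S : Set (Fin n → ℤ)} {w : Fin n → ℤ} (hw : w ∉ S)
    {z g : (Matrix (Idx n) (Idx n) A)ˣ} (hz : z ∈ (whole F).rootGroup w) (hg : g ∈ P.genConj S) :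
    z * g * z⁻¹ ∈ P.genConj (S ∪ {-w}) := by
  induction hg using Subgroup.closure_induction with
  | mem g hg =>
    rcases hg with ⟨v, hg⟩ | ⟨v, hv, hg⟩
    · by_cases h : w + v = 0
      · obtain rfl : v = -w := (neg_eq_of_add_eq_zero_right h).symm
        exact conjSet_subset_genConj (Or.inr rfl) ⟨z, by rwa [neg_neg], g, hg, rfl⟩
      · exact FU_le_genConj _ (conj_mem_FU h hz hg)
    · have hvw : w ≠ v := fun h => hw (h ▸ hv)
      by_cases h : w = -v
      · subst h
        obtain ⟨t, ht, y, hy, rfl⟩ := hg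
        refine conjSet_subset_genConj (Or.inl hv) ⟨z * t, mul_mem hz ht, y, hy, ?_⟩
        group
      · have hg' := conjSet_subset_genConj (S := S ∪ {-w}) (Or.inl hv) hg
        have key : ⁅g, z⁆ ∈ P.genConj (S ∪ {-w}) := by
          obtain ⟨t, ht, y, hy, hgy⟩ := id hg
          rcases exists_functional_of_mem hy hz hvw h with rfl | rfl | ⟨φ, h1, h2⟩
          · rw [mul_one, mul_inv_cancel] at hgy
            rw [hgy]
            simp
          · simp
          · exact FU_le_genConj _ (upper_le_FU φ
              (commutator_conj_upper_mem h1 hg (rootGroup_le_upper h2 hz)))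
        have := mul_mem (inv_mem key) hg'
        rwa [commutatorElement_inv, ← conj_eq_commutator_mul] at this
  | one => simp
  | mul a b _ _ ha hb =>
    have := mul_mem ha hb
    rwa [conj_mul] at this
  | inv a _ ha =>
    have := inv_mem ha
    rwa [conj_inv] at this

theorem rootGroup_le_normalizer_genConj {S : Set (Fin n → ℤ)} {w : Fin n → ℤ} (hw : w ∉ S)
    (hw' : -w ∈ S) :
    (whole F).rootGroup w
      ≤ Subgroup.normalizer (P.genConj S : Set (Matrix (Idx n) (Idx n) A)ˣ) := by
  refine Subgroup.le_normalizer_of_conj_mem fun z hz g hg => ?_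
  have := conj_mem_genConj hw hz hg
  rwa [Set.union_singleton, Set.insert_eq_of_mem hw'] at this

theorem exists_third (hn : 3 ≤ n) (i j : Idx n) :
    ∃ k : Idx n, k ≠ i ∧ k ≠ i.opp ∧ k ≠ j ∧ k ≠ j.opp := by
  have ex : ∀ a b : Fin n, ∃ c : Fin n, c ≠ a ∧ c ≠ b := by
    intro a b
    obtain ⟨c, hc⟩ : ∃ c, c ∉ ({a, b} : Finset (Fin n)) := by
      by_contra! h
      have h1 := Finset.card_le_card (fun x _ => h x : Finset.univ ⊆ ({a, b} : Finset (Fin n)))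
      have h2 := Finset.card_le_two (a := a) (b := b)
      rw [Finset.card_univ, Fintype.card_fin] at h1
      omega
    exact ⟨c, by simpa using hc⟩
  rcases i with i | i <;> rcases j with j | j <;>
  · obtain ⟨c, h1, h2⟩ := ex i j
    exact ⟨Sum.inl c, by simp [opp, h1, h2]⟩

/-- Each long root transvection is a product of transvections for the roots `e_k - e_j`, `2 e_k` and
a conjugate of the inverse of the latter. -/
theorem T_long_eq {j k : Idx n} (hkj : k ≠ j) (hkj' : j ≠ k.opp) {a : A}
    (ha : a ∈ P.lev j.opp j) :
    ∃ b ∈ P.lev k k.opp, F.T j.opp j a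
      = (F.T k j b)⁻¹ *
        (F.T k k.opp b * (F.T k.opp j 1 * (F.T k k.opp b)⁻¹ * (F.T k.opp j 1)⁻¹)) := by
  have hb : -(F.mu j k.opp * a) ∈ P.lev k k.opp := by
    have h := mem_lev_long (P := P) (i := j.opp) (a := a)
    rw [opp_opp] at h
    rw [h] at ha
    rw [mem_lev_long, mul_neg, ← F.mu_opp, opp_opp, ← mul_assoc, F.lamI_mul_mu]
    exact neg_mem ha
  refine ⟨_, hb, ?_⟩
  have := F.T_commutator_long hkj hkj' (lev_le_whole hb) 1
  rw [star_one, one_mul, mul_one, mul_neg, neg_neg, F.mu_mul_mu_assoc, F.mu_self, one_mul] at this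
  rw [eq_inv_mul_iff_mul_eq, ← this]
  simp only [mul_assoc]

/-- Each short root transvection is a product of a transvection for `e_i - e_k` and a conjugate of
its inverse. -/
theorem T_short_eq {i j k : Idx n} (hij : i ≠ j) (hij' : j ≠ i.opp) (h1 : k ≠ i) (h2 : k ≠ i.opp)
    (h3 : k ≠ j) (h4 : k ≠ j.opp) (a : A) :
    F.T i j a = F.T i k a * (F.T k j 1 * (F.T i k a)⁻¹ * (F.T k j 1)⁻¹) := by
  have h4' : j ≠ k.opp := fun h => h4 (eq_opp_comm.1 h)
  have := F.T_commutator_short h1.symm h2 h3 h4' hij hij' a 1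
  rw [mul_one] at this
  rw [← this]
  simp only [mul_assoc]

/-- Root subgroups are generated by those for other roots: for each root `v` there is a set `R` of
roots with `±v ∉ R` and `R ∩ -R = ∅` such that every subgroup which contains the root subgroups of
some level for `R` and is normalised by the absolute ones contains that for `v`. -/
theorem exists_generating_roots (F : FormRing A) (hn : 3 ≤ n) {i j : Idx n} (hij : i ≠ j) :
    ∃ R : Set (Fin n → ℤ), root i j ∉ R ∧ -root i j ∉ R ∧ (∀ w ∈ R, -w ∉ R) ∧
      ∀ (P : FormIdeal F) (N : Subgroup (Matrix (Idx n) (Idx n) A)ˣ),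
        (∀ w ∈ R, P.rootGroup w ≤ N) →
        (∀ w ∈ R, (whole F).rootGroup w
          ≤ Subgroup.normalizer (N : Set (Matrix (Idx n) (Idx n) A)ˣ)) →
        P.rootGroup (root i j) ≤ N := by
  obtain ⟨k, h1, h2, h3, h4⟩ := exists_third hn i j
  have e1 : i ≠ k.opp := fun h => h2 (eq_opp_comm.1 h)
  have e2 : j ≠ k.opp := fun h => h4 (eq_opp_comm.1 h)
  have e3 : j.opp ≠ k := h4.symm
  by_cases hij' : j = i.opp
  · have hi : i = j.opp := eq_opp_comm.2 hij'
    subst hi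
    have c0 : k.coord (root j.opp j) = 0 := by
      simp [coord_root, coord_vec, h3.symm, e1, e2, e3]
    have c1 : k.coord (root k j) = 1 := by
      simp [coord_root, coord_vec, h3.symm, e2]
    have c2 : k.coord (root k k.opp) = 2 := by
      simp [coord_root, coord_vec, k.opp_ne]
    have c3 : k.coord (root k.opp j) = -1 := by
      simp [coord_root, coord_vec, h3.symm, k.opp_ne, e2]
    have d1 : j.coord (root k j) = -1 := by
      simp [coord_root, coord_vec, h3, h4]
    have d3 : j.coord (root k.opp j) = -1 := by
      simp [coord_root, coord_vec, vec_opp, h3, h4]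
    refine ⟨{root k j, root k k.opp, root k.opp j}, ?_, ?_, ?_, ?_⟩
    · rintro (h | h | h) <;> rw [h] at c0 <;> omega
    · intro h
      have c0' : k.coord (-root j.opp j) = 0 := by rw [map_neg, c0, neg_zero]
      rcases h with h | h | h <;> rw [h] at c0' <;> omega
    · rintro w hw hw'
      have hc : k.coord (-w) = -k.coord w := map_neg _ _
      have hd : j.coord (-w) = -j.coord w := map_neg _ _
      rcases hw with hw | hw | hw <;> rcases hw' with hw' | hw' | hw' <;>
        rw [hw] at hc hd hw' <;> rw [hw'] at hc hd <;> omega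
    · intro P N hP hN g hg
      obtain ⟨a, ha, rfl⟩ := exists_T_of_mem_rootGroup hij hg
      obtain ⟨b, hb, e⟩ := T_long_eq h3 e2 ha
      have hb2 : F.T k k.opp b ∈ N :=
        hP _ (Or.inr (Or.inl rfl)) (T_mem_rootGroup k.opp_ne.symm hb)
      rw [e]
      refine mul_mem (inv_mem (hP _ (Or.inl rfl) (T_mem_rootGroup h3 ?_))) (mul_mem hb2 ?_)
      · exact (mem_lev_short e2).2 (lev_le_ideal hb)
      · refine Subgroup.conj_mem_of_mem_normalizer (hN _ (Or.inr (Or.inr rfl))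
          (T_mem_rootGroup e2.symm ?_)) (inv_mem hb2)
        exact (mem_lev_short (by rw [opp_opp]; exact h3.symm)).2 trivial
  · have c0 : k.coord (root i j) = 0 := by
      simp [coord_root, coord_vec, h1.symm, h3.symm, e1, e2]
    have c1 : k.coord (root i k) = -1 := by
      simp [coord_root, coord_vec, h1.symm, e1]
    have c2 : k.coord (root k j) = 1 := by
      simp [coord_root, coord_vec, h3.symm, e2]
    have d1 : i.coord (root i k) = 1 := by
      simp [coord_root, coord_vec, h1, h2]
    have d2 : i.coord (root k j) = 0 := by
      simp [coord_root, coord_vec, h1, h2, hij.symm, hij']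
    refine ⟨{root i k, root k j}, ?_, ?_, ?_, ?_⟩
    · rintro (h | h) <;> rw [h] at c0 <;> omega
    · intro h
      have c0' : k.coord (-root i j) = 0 := by rw [map_neg, c0, neg_zero]
      rcases h with h | h <;> rw [h] at c0' <;> omega
    · rintro w hw hw'
      have hc : k.coord (-w) = -k.coord w := map_neg _ _
      have hd : i.coord (-w) = -i.coord w := map_neg _ _
      rcases hw with hw | hw <;> rcases hw' with hw' | hw' <;>
        rw [hw] at hc hd hw' <;> rw [hw'] at hc hd <;> omega
    · intro P N hP hN g hg
      obtain ⟨a, ha, rfl⟩ := exists_T_of_mem_rootGroup hij hg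
      rw [T_short_eq hij hij' h1 h2 h3 h4]
      have ha2 : F.T i k a ∈ N :=
        hP _ (Or.inl rfl) (T_mem_rootGroup h1.symm ((mem_lev_short h2).2 (lev_le_ideal ha)))
      refine mul_mem ha2 (Subgroup.conj_mem_of_mem_normalizer (hN _ (Or.inr rfl)
        (T_mem_rootGroup h3 ?_)) (inv_mem ha2))
      exact (mem_lev_short e2).2 trivial

/-- The only critical case is that of an elementary conjugate for the root `w` itself. If `w` is
generated by `R`, put `S = {w} ∪ -R`; the subgroup `genConj S` is normalised by the root subgroups
for `R`, hence also by the root subgroup for `w`. -/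
theorem rootGroup_le_normalizer_genConj_univ (hn : 3 ≤ n) (w : Fin n → ℤ) :
    (whole F).rootGroup w
      ≤ Subgroup.normalizer
        ((P.genConj Set.univ : Subgroup (Matrix (Idx n) (Idx n) A)ˣ) : Set _) := by
  refine Subgroup.le_normalizer_closure ?_
  intro z hz g hg
  change z * g * z⁻¹ ∈ P.genConj Set.univ
  rcases hg with ⟨v, hg⟩ | ⟨v, -, hg⟩
  · exact genConj_mono (Set.subset_univ _)
      (conj_mem_genConj (Set.notMem_empty _) hz (rootGroup_le_genConj _ v hg))
  by_cases hwv : w = v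
  · subst hwv
    rcases eq_one_or_exists_T hz with rfl | ⟨i, j, hij, rfl, -⟩
    · simpa using conjSet_subset_genConj (Set.mem_univ _) hg
    obtain ⟨R, hR1, hR2, hR3, hR⟩ := exists_generating_roots F hn hij
    have hS : ∀ u ∈ R, u ∉ ({root i j} ∪ {u | -u ∈ R} : Set (Fin n → ℤ)) := by
      rintro u hu (rfl | h)
      · exact hR1 hu
      · exact hR3 u hu h
    have hN : ∀ u ∈ R, (whole F).rootGroup u ≤ Subgroup.normalizer
        (P.genConj ({root i j} ∪ {u | -u ∈ R}) : Set (Matrix (Idx n) (Idx n) A)ˣ) :=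
      fun u hu => rootGroup_le_normalizer_genConj (hS u hu)
        (Or.inr (by simpa only [Set.mem_ofPred_eq, neg_neg] using hu))
    have hz' := hR (whole F) _ hN (fun u hu => (hN u hu).trans Subgroup.le_normalizer) hz
    have hg' := conjSet_subset_genConj (S := {root i j} ∪ {u | -u ∈ R}) (Or.inl rfl) hg
    exact genConj_mono (Set.subset_univ _) (Subgroup.conj_mem_of_mem_normalizer hz' hg')
  · have hg' := conjSet_subset_genConj (Set.mem_singleton v) hg
    exact genConj_mono (Set.subset_univ _)
      (conj_mem_genConj (S := {v}) (fun h => hwv (Set.mem_singleton_iff.1 h)) hz hg')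

/-- The relative elementary group is generated by the elementary conjugates. -/
theorem EU_eq_genConj (hn : 3 ≤ n) : P.EU n = P.genConj Set.univ := by
  have hE : F.absEU n
      ≤ Subgroup.normalizer
        ((P.genConj Set.univ : Subgroup (Matrix (Idx n) (Idx n) A)ˣ) : Set _) :=
    FU_le_of_rootGroup_le (P := whole F) (rootGroup_le_normalizer_genConj_univ hn)
  apply le_antisymm
  · refine (Subgroup.closure_le _).2 ?_
    rintro _ ⟨x, hx, y, hy, rfl⟩
    exact Subgroup.conj_mem_of_mem_normalizer (hE hx) (FU_le_genConj _ hy)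
  · refine (Subgroup.closure_le _).2 ?_
    rintro g (⟨v, hg⟩ | ⟨v, -, t, ht, y, hy, rfl⟩)
    · exact Subgroup.subset_closure ⟨1, one_mem _, g, rootGroup_le_FU v hg, by simp⟩
    · exact Subgroup.subset_closure
        ⟨t, rootGroup_le_absEU _ ht, y, rootGroup_le_FU _ hy, rfl⟩

theorem absEU_le_normalizer_EU :
    F.absEU n ≤ Subgroup.normalizer (P.EU n : Set (Matrix (Idx n) (Idx n) A)ˣ) := by
  refine Subgroup.le_normalizer_closure ?_
  rintro z hz _ ⟨x, hx, y, hy, rfl⟩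
  exact Subgroup.subset_closure ⟨z * x, mul_mem hz hx, y, hy, by group⟩

theorem FU_le_EU : P.FU n ≤ P.EU n :=
  fun y hy => Subgroup.subset_closure ⟨1, one_mem _, y, hy, by simp⟩

theorem FU_le_absEU : P.FU n ≤ F.absEU n :=
  FU_le_of_rootGroup_le fun v => (rootGroup_le_whole v).trans (rootGroup_le_absEU v)

end FormIdeal

/-! ### Elementary commutators are central modulo the symmetrised product -/

namespace FormIdeal

open Idx
open scoped commutatorElement

variable {A : Type*} [Ring A] [StarRing A] {F : FormRing A} {n : ℕ} {P Q : FormIdeal F}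

theorem rootGroup_le_normalizer {H : Subgroup (Matrix (Idx n) (Idx n) A)ˣ}
    (hE : F.absEU n ≤ Subgroup.normalizer (H : Set (Matrix (Idx n) (Idx n) A)ˣ))
    (v : Fin n → ℤ) :
    P.rootGroup v ≤ Subgroup.normalizer (H : Set (Matrix (Idx n) (Idx n) A)ˣ) :=
  (rootGroup_le_FU v).trans (FU_le_absEU.trans hE)

theorem commutator_mem_EU_circ {v w : Fin n → ℤ} (hvw : v + w ≠ 0)
    {x y : (Matrix (Idx n) (Idx n) A)ˣ} (hx : x ∈ P.rootGroup v) (hy : y ∈ Q.rootGroup w) :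
    ⁅x, y⁆ ∈ (P.circ Q).EU n :=
  commutator_mem_of_add_ne_zero hvw hx hy fun _ _ _ _ => (rootGroup_le_FU _).trans FU_le_EU

theorem commutator_upper_rootGroup_mem {φ : (Fin n → ℤ) →+ ℤ} {v : Fin n → ℤ} (hv : 0 ≤ φ v)
    {x y : (Matrix (Idx n) (Idx n) A)ˣ} (hx : x ∈ P.upper φ) (hy : y ∈ Q.rootGroup v) :
    ⁅x, y⁆ ∈ (P.circ Q).EU n := by
  rw [commutator_mem_comm]
  refine commutator_mem_of_mem_closure (Y := {g | ∃ v, 0 < φ v ∧ g ∈ P.rootGroup v})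
    (fun g ⟨w, _, hg⟩ => rootGroup_le_normalizer absEU_le_normalizer_EU w hg) ?_ hx
  rintro g ⟨w, hw, hg⟩
  rw [commutator_mem_comm]
  exact commutator_mem_EU_circ (add_ne_zero_of_apply_pos (φ := φ) (by omega)) hg hy

theorem commutator_upper_upper_mem {φ : (Fin n → ℤ) →+ ℤ}
    {x y : (Matrix (Idx n) (Idx n) A)ˣ} (hx : x ∈ P.upper φ) (hy : y ∈ Q.upper φ) :
    ⁅x, y⁆ ∈ (P.circ Q).EU n := by
  refine commutator_mem_of_mem_closure (Y := {g | ∃ v, 0 < φ v ∧ g ∈ Q.rootGroup v})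
    (fun g ⟨w, _, hg⟩ => rootGroup_le_normalizer absEU_le_normalizer_EU w hg) ?_ hy
  rintro g ⟨w, hw, hg⟩
  exact commutator_upper_rootGroup_mem hw.le hx hg

/-- An elementary commutator for the root `v` commutes with the root subgroups for `w ≠ ±v` modulo
the symmetrised product: conjugation by the latter changes both entries of the commutator by
elements of a unipotent radical. -/
theorem rootGroup_le_centMod_commutator {v w : Fin n → ℤ} (h1 : w ≠ v) (h2 : w ≠ -v)
    {x y : (Matrix (Idx n) (Idx n) A)ˣ} (hx : x ∈ P.rootGroup (-v)) (hy : y ∈ Q.rootGroup v) :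
    (whole F).rootGroup w ≤ centMod ((P.circ Q).EU n) {⁅x, y⁆} := by
  have nE : F.absEU n ≤
      Subgroup.normalizer ((P.circ Q).EU n : Set (Matrix (Idx n) (Idx n) A)ˣ) :=
    absEU_le_normalizer_EU
  intro z hz
  refine ⟨rootGroup_le_normalizer nE _ hz, ?_⟩
  rintro _ rfl
  rcases exists_functional_of_mem hy hz h1 h2 with rfl | rfl | ⟨φ, hv, hw⟩
  · simp
  · simp
  have hv' : φ (-v) = 0 := by rw [map_neg, hv, neg_zero]
  have hu : ⁅x⁻¹, z⁆ ∈ P.upper φ := by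
    rw [commutator_mem_comm]
    refine commutator_whole_mem (add_ne_zero_of_apply_pos (φ := φ) (by omega)) hz (inv_mem hx)
      fun p q hp _ => ?_
    rw [add_comm]
    exact rootGroup_le_upper (apply_comb_pos hv'.ge hw hp)
  have hs : ⁅y⁻¹, z⁆ ∈ Q.upper φ := by
    rw [commutator_mem_comm]
    refine commutator_whole_mem (add_ne_zero_of_apply_pos (φ := φ) (by omega)) hz (inv_mem hy)
      fun p q hp _ => ?_
    rw [add_comm]
    exact rootGroup_le_upper (apply_comb_pos hv.ge hw hp)
  set u := ⁅x⁻¹, z⁆ with hu_def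
  set s := ⁅y⁻¹, z⁆ with hs_def
  have nx := rootGroup_le_normalizer nE _ hx
  have ny := rootGroup_le_normalizer nE _ hy
  have huy := commutator_upper_rootGroup_mem hv.ge hu hy
  have hus := commutator_upper_upper_mem hu hs
  have hxs : ⁅x, s⁆ ∈ (P.circ Q).EU n := by
    rw [commutator_mem_comm, circ_comm]
    exact commutator_upper_rootGroup_mem hv'.ge hs hx
  have hu_ys : ⁅u, y * s⁆ ∈ (P.circ Q).EU n := by
    have := mul_mem huy (Subgroup.conj_mem_of_mem_normalizer ny hus)
    convert this using 1
    simp only [commutatorElement_def]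
    group
  have nc : ⁅x, y⁆ ∈ Subgroup.normalizer ((P.circ Q).EU n : Set (Matrix (Idx n) (Idx n) A)ˣ) := by
    rw [commutatorElement_def]
    exact mul_mem (mul_mem (mul_mem nx ny) (inv_mem nx)) (inv_mem ny)
  have h3 := mul_mem (Subgroup.conj_mem_of_mem_normalizer nx hu_ys)
    (Subgroup.conj_mem_of_mem_normalizer nc (Subgroup.conj_mem_of_mem_normalizer ny hxs))
  convert h3 using 1
  -- `z x z⁻¹ = x u` and `z y z⁻¹ = y s`
  rw [hu_def, hs_def]
  simp only [commutatorElement_def]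
  group

/-- Elementary commutators are central modulo the symmetrised product: the root subgroups for `±v`,
which the preceding lemma leaves out, are generated from other roots. -/
theorem absEU_le_centMod_commutator (hn : 3 ≤ n) {v : Fin n → ℤ}
    {x y : (Matrix (Idx n) (Idx n) A)ˣ} (hx : x ∈ P.rootGroup (-v)) (hy : y ∈ Q.rootGroup v) :
    F.absEU n ≤ centMod ((P.circ Q).EU n) {⁅x, y⁆} := by
  rcases eq_one_or_exists_T hy with rfl | ⟨i, j, hij, rfl, -⟩
  · refine fun z hz => ⟨absEU_le_normalizer_EU hz, ?_⟩
    rintro _ rfl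
    simp
  refine FU_le_of_rootGroup_le (P := whole F) fun w => ?_
  by_cases h1 : w = root i j
  · subst h1
    obtain ⟨R, hR1, hR2, -, hR⟩ := exists_generating_roots F hn hij
    have key : ∀ w ∈ R, (whole F).rootGroup w ≤ centMod ((P.circ Q).EU n) {⁅x, y⁆} :=
      fun w hw => rootGroup_le_centMod_commutator (fun h => hR1 (by rwa [← h]))
        (fun h => hR2 (by rwa [← h])) hx hy
    exact hR _ _ key fun w hw => (key w hw).trans Subgroup.le_normalizer
  by_cases h2 : w = -root i j
  · rw [neg_root] at h2
    subst h2
    obtain ⟨R, hR1, hR2, -, hR⟩ := exists_generating_roots F hn hij.symm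
    rw [neg_root] at hR2
    have key : ∀ w ∈ R, (whole F).rootGroup w ≤ centMod ((P.circ Q).EU n) {⁅x, y⁆} :=
      fun w hw => rootGroup_le_centMod_commutator (fun h => hR2 (by rwa [← h]))
        (fun h => hR1 (by rwa [← neg_root, ← h])) hx hy
    exact hR _ _ key fun w hw => (key w hw).trans Subgroup.le_normalizer
  exact rootGroup_le_centMod_commutator h1 h2 hx hy

/-! ### The symmetrised product lies in the mixed commutator subgroup -/

theorem circIdeal_induction {p : A → Prop} (h1 : ∀ u ∈ P.I, ∀ v ∈ Q.I, p (u * v))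
    (h2 : ∀ u ∈ P.I, ∀ v ∈ Q.I, p (v * u)) (h3 : ∀ x ∈ circIdeal P Q, ∀ y ∈ circIdeal P Q,
      p x → p y → p (x + y)) {a : A} (ha : a ∈ circIdeal P Q) : p a := by
  have h4 : ∀ x ∈ P.I * Q.I, p x := by
    intro x hx
    induction hx using Submodule.mul_induction_on' with
    | mem_mul_mem u hu v hv => exact h1 u hu v hv
    | add x hx y hy h h' => exact h3 _ (Ideal.mem_sup_left hx) _ (Ideal.mem_sup_left hy) h h'
  have h5 : ∀ x ∈ Q.I * P.I, p x := by
    intro x hx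
    induction hx using Submodule.mul_induction_on' with
    | mem_mul_mem v hv u hu => exact h2 u hu v hv
    | add x hx y hy h h' => exact h3 _ (Ideal.mem_sup_right hx) _ (Ideal.mem_sup_right hy) h h'
  obtain ⟨x, hx, y, hy, rfl⟩ := Submodule.mem_sup.1 ha
  exact h3 _ (Ideal.mem_sup_left hx) _ (Ideal.mem_sup_right hy) (h4 x hx) (h5 y hy)

theorem T_mem_EU {i j : Idx n} (hij : i ≠ j) {a : A} (ha : a ∈ P.lev i j) :
    F.T i j a ∈ P.EU n :=
  FU_le_EU (rootGroup_le_FU _ (T_mem_rootGroup hij ha))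

theorem T_short_mul_mem (hn : 3 ≤ n) {i j : Idx n} (hij : i ≠ j) (hij' : j ≠ i.opp) {u v : A}
    (hu : u ∈ P.I) (hv : v ∈ Q.I) : F.T i j (u * v) ∈ ⁅P.EU n, Q.EU n⁆ := by
  obtain ⟨k, h1, h2, h3, h4⟩ := exists_third hn i j
  have h4' : j ≠ k.opp := fun h => h4 (eq_opp_comm.1 h)
  rw [← F.T_commutator_short h1.symm h2 h3 h4' hij hij', ← commutatorElement_def]
  exact Subgroup.commutator_mem_commutator (T_mem_EU h1.symm ((mem_lev_short h2).2 hu))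
    (T_mem_EU h3 ((mem_lev_short h4').2 hv))

theorem T_short_mem_commutator (hn : 3 ≤ n) {i j : Idx n} (hij : i ≠ j) (hij' : j ≠ i.opp) {a : A}
    (ha : a ∈ circIdeal P Q) : F.T i j a ∈ ⁅P.EU n, Q.EU n⁆ := by
  refine circIdeal_induction (p := fun a => F.T i j a ∈ ⁅P.EU n, Q.EU n⁆) ?_ ?_ ?_ ha
  · exact fun u hu v hv => T_short_mul_mem hn hij hij' hu hv
  · intro u hu v hv
    rw [Subgroup.commutator_comm]
    exact T_short_mul_mem hn hij hij' hv hu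
  · intro x _ y _ hx hy
    rw [F.T_add hij]
    exact mul_mem hx hy

theorem T_long_sub_mul_mem (hn : 3 ≤ n) (i : Idx n) {u v : A} (hu : u ∈ P.I) (hv : v ∈ Q.I) :
    F.T i i.opp (u * v - F.mu i i.opp * star (u * v)) ∈ ⁅P.EU n, Q.EU n⁆ := by
  obtain ⟨k, h1, h2, -, -⟩ := exists_third hn i i
  have h3 : i.opp ≠ k.opp := fun h => h1 (opp_inj.1 h).symm
  rw [← F.T_commutator_short_to_long h1.symm h2, ← commutatorElement_def]
  exact Subgroup.commutator_mem_commutator (T_mem_EU h1.symm ((mem_lev_short h2).2 hu))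
    (T_mem_EU h2 ((mem_lev_short h3).2 hv))

theorem T_long_sub_mem_commutator (hn : 3 ≤ n) (i : Idx n) {a : A} (ha : a ∈ circIdeal P Q) :
    F.T i i.opp (a - F.mu i i.opp * star a) ∈ ⁅P.EU n, Q.EU n⁆ := by
  refine circIdeal_induction
    (p := fun a => F.T i i.opp (a - F.mu i i.opp * star a) ∈ ⁅P.EU n, Q.EU n⁆) ?_ ?_ ?_ ha
  · exact fun u hu v hv => T_long_sub_mul_mem hn i hu hv
  · intro u hu v hv
    rw [Subgroup.commutator_comm]
    exact T_long_sub_mul_mem hn i hv hu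
  · intro x _ y _ hx hy
    rw [star_add, mul_add, add_sub_add_comm, F.T_add i.opp_ne.symm]
    exact mul_mem hx hy

theorem T_long_conj_mem (hn : 3 ≤ n) (i : Idx n) {b x : A} (hb : b ∈ Q.I) (hx : x ∈ P.Gam) :
    F.T i i.opp (star (F.lamI i) * (b * x * star b)) ∈ ⁅P.EU n, Q.EU n⁆ := by
  obtain ⟨k, h1, h2, -, -⟩ := exists_third hn i i
  have h3 : i.opp ≠ k.opp := fun h => h1 (opp_inj.1 h).symm
  have ha : -(star (F.lamI k) * x) ∈ P.lev k k.opp := by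
    rw [mem_lev_long, mul_neg, F.lamI_mul_cancel]
    exact neg_mem hx
  have hb' : star b ∈ Q.lev k.opp i.opp := by
    rw [mem_lev_short (by rw [opp_opp]; exact h2.symm)]
    exact Q.star_mem _ hb
  have hc := F.T_commutator_long h2 h3 (lev_le_whole ha) (star b)
  have hmem := Subgroup.commutator_mem_commutator (T_mem_EU k.opp_ne.symm ha)
    (T_mem_EU h3.symm hb')
  rw [commutatorElement_def, hc] at hmem
  have hs : F.T k i.opp (-(star (F.lamI k) * x) * star b) ∈ ⁅P.EU n, Q.EU n⁆ :=
    T_short_mem_commutator hn h2 h3 (mul_mem_circ (lev_le_ideal ha) (Q.star_mem _ hb))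
  have := (Subgroup.mul_mem_cancel_left _ hs).1 hmem
  rw [opp_opp] at this
  convert this using 2
  have e : F.mu k.opp i.opp * star (F.lamI k) = star (F.lamI i) := by
    rw [F.mu_opp, FormRing.mu, mul_assoc, F.star_lamI_central, F.lamI_mul_cancel]
  rw [star_star, mul_neg, neg_mul, mul_neg, neg_neg, ← mul_assoc b, ← F.star_lamI_central, ← e]
  simp only [mul_assoc]

theorem FU_circ_le_commutator (hn : 3 ≤ n) : (P.circ Q).FU n ≤ ⁅P.EU n, Q.EU n⁆ := by
  refine (Subgroup.closure_le _).2 ?_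
  rintro _ ⟨i, j, hij, a, ha, rfl⟩
  by_cases hij' : j = i.opp
  · subst hij'
    let S : AddSubgroup A :=
      { carrier := {y | F.T i i.opp (star (F.lamI i) * y) ∈ ⁅P.EU n, Q.EU n⁆}
        zero_mem' := by simp [F.T_zero]
        add_mem' := by
          intro x y hx hy
          change F.T i i.opp _ ∈ ⁅P.EU n, Q.EU n⁆
          rw [mul_add, F.T_add hij]
          exact mul_mem hx hy
        neg_mem' := by
          intro x hx
          change F.T i i.opp _ ∈ ⁅P.EU n, Q.EU n⁆
          rw [mul_neg, F.T_neg hij]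
          exact inv_mem hx }
    have h1 : ∀ a ∈ circIdeal P Q, a - F.lam * star a ∈ S := by
      intro a ha
      have := T_long_sub_mem_commutator hn i
        (Ideal.mul_mem_left _ (star (F.lamI i)) ha)
      change F.T i i.opp _ ∈ ⁅P.EU n, Q.EU n⁆
      convert this using 2
      rw [mul_sub, star_mul, star_star, ← F.lamI_mul_lamI_opp i, mul_assoc, F.star_lamI_mul_cancel,
        ← F.lamI_central, FormRing.mu, mul_assoc, F.star_lamI_mul_cancel]
    have h3 : ∀ b ∈ Q.I, ∀ x ∈ P.Gam, b * x * star b ∈ S :=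
      fun b hb x hx => T_long_conj_mem hn i hb hx
    have h4 : ∀ b ∈ P.I, ∀ x ∈ Q.Gam, b * x * star b ∈ S := by
      intro b hb x hx
      change F.T i i.opp _ ∈ ⁅P.EU n, Q.EU n⁆
      rw [Subgroup.commutator_comm]
      exact T_long_conj_mem hn i hb hx
    have h2 : ∀ a ∈ circIdeal P Q, ∀ c ∈ F.Lam, a * c * star a ∈ S := by
      intro a ha
      refine circIdeal_induction (p := fun a => ∀ c ∈ F.Lam, a * c * star a ∈ S) ?_ ?_ ?_ ha
      · intro u hu v hv c hc
        have := h4 u hu _ (Q.min_le (AddSubgroup.subset_closure (Or.inr ⟨v, hv, c, hc, rfl⟩)))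
        simpa only [star_mul, mul_assoc] using this
      · intro u hu v hv c hc
        have := h3 v hv _ (P.min_le (AddSubgroup.subset_closure (Or.inr ⟨u, hu, c, hc, rfl⟩)))
        simpa only [star_mul, mul_assoc] using this
      · intro x hx y hy hx' hy' c hc
        have := circIdeal_twoSided P Q
        -- The cross terms form an element `z - λ star z`.
        have hz := h1 (x * c * star y) (Ideal.mul_mem_right _ _ (Ideal.mul_mem_right _ _ hx))
        have e : (x + y) * c * star (x + y) = x * c * star x + y * c * star y
            + (x * c * star y - F.lam * star (x * c * star y)) := by
          have e2 : F.lam * star (x * c * star y) = -(y * c * star x) := by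
            rw [star_mul, star_mul, star_star, F.star_of_mem_Lam hc, ← mul_assoc, F.lam_central,
              mul_assoc, ← mul_assoc F.lam, mul_neg, ← mul_assoc F.lam, F.lam_mul_star]
            simp [mul_assoc]
          rw [e2, star_add]
          noncomm_ring
        rw [e]
        exact add_mem (add_mem (hx' c hc) (hy' c hc)) hz
    have := circGam_le P Q S h1 h2 h3 h4 (mem_lev_long.1 ha)
    change F.T i i.opp _ ∈ ⁅P.EU n, Q.EU n⁆ at this
    rwa [F.star_lamI_mul_cancel] at this
  · exact T_short_mem_commutator hn hij hij' ((mem_lev_short hij').1 ha)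

theorem absEU_le_normalizer_commutator :
    F.absEU n
      ≤ Subgroup.normalizer
        ((⁅P.EU n, Q.EU n⁆ : Subgroup (Matrix (Idx n) (Idx n) A)ˣ) : Set _) := by
  refine Subgroup.le_normalizer_closure ?_
  rintro z hz _ ⟨x, hx, y, hy, rfl⟩
  rw [conjugate_commutatorElement]
  exact Subgroup.subset_closure
    ⟨_, Subgroup.conj_mem_of_mem_normalizer (absEU_le_normalizer_EU hz) hx, _,
      Subgroup.conj_mem_of_mem_normalizer (absEU_le_normalizer_EU hz) hy, rfl⟩

theorem EU_circ_le_commutator (hn : 3 ≤ n) : (P.circ Q).EU n ≤ ⁅P.EU n, Q.EU n⁆ := by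
  refine (Subgroup.closure_le _).2 ?_
  rintro _ ⟨x, hx, y, hy, rfl⟩
  exact Subgroup.conj_mem_of_mem_normalizer (absEU_le_normalizer_commutator hx)
    (FU_circ_le_commutator hn hy)

/-! ### Elementary conjugates of the symmetrised product -/

theorem Z_eq {i j : Idx n} (hij : i ≠ j) (a c : A) :
    F.Z i j a c = F.T j i c * F.T i j a * (F.T j i c)⁻¹ := by
  rw [FormRing.Z, F.T_neg hij.symm]

theorem Z_mem_EU {i j : Idx n} (hij : i ≠ j) {a c : A} (ha : a ∈ P.lev i j)
    (hc : c ∈ (whole F).lev j i) : F.Z i j a c ∈ P.EU n := by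
  rw [Z_eq hij]
  exact Subgroup.subset_closure ⟨_, rootGroup_le_absEU _ (T_mem_rootGroup hij.symm hc), _,
    rootGroup_le_FU _ (T_mem_rootGroup hij ha), rfl⟩

theorem EU_le_of_Z_mem (hn : 3 ≤ n) {N : Subgroup (Matrix (Idx n) (Idx n) A)ˣ}
    (h : ∀ i j : Idx n, i ≠ j → ∀ a ∈ P.lev i j, ∀ c ∈ (whole F).lev j i, F.Z i j a c ∈ N) :
    P.EU n ≤ N := by
  rw [EU_eq_genConj hn]
  refine (Subgroup.closure_le _).2 ?_
  rintro g (⟨v, hg⟩ | ⟨v, -, t, ht, y, hy, rfl⟩)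
  · rcases eq_one_or_exists_T hg with rfl | ⟨i, j, hij, rfl, a, ha, rfl⟩
    · exact one_mem N
    · simpa [FormRing.Z, F.T_zero] using h i j hij a ha 0 lev_zero
  · rcases eq_one_or_exists_T hy with rfl | ⟨i, j, hij, rfl, a, ha, rfl⟩
    · simp
    · rw [neg_root] at ht
      obtain ⟨c, hc, rfl⟩ := exists_T_of_mem_rootGroup hij.symm ht
      rw [← Z_eq hij]
      exact h i j hij a ha c hc

theorem EU_circ_le_of_subset (hn : 3 ≤ n) {N : Subgroup (Matrix (Idx n) (Idx n) A)ˣ}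
    (h1 : P.shortZ Q n ⊆ N) (h2 : P.longZ Q n ⊆ N) : (P.circ Q).EU n ≤ N := by
  refine EU_le_of_Z_mem hn fun i j hij a ha c hc => ?_
  by_cases hij' : j = i.opp
  · subst hij'
    exact h2 ⟨i, a, ha, c, hc, rfl⟩
  · refine circIdeal_induction (p := fun a => F.Z i j a c ∈ N) ?_ ?_ ?_ ((mem_lev_short hij').1 ha)
    · exact fun u hu v hv => h1 ⟨i, j, hij, hij', u, hu, v, hv, c, Or.inl rfl⟩
    · exact fun u hu v hv => h1 ⟨i, j, hij, hij', u, hu, v, hv, c, Or.inr rfl⟩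
    · intro x _ y _ hx hy
      have := mul_mem hx hy
      rw [Z_eq hij, Z_eq hij, conj_mul, ← F.T_add hij, ← Z_eq hij] at this
      exact this

theorem shortZ_subset_EU_circ : P.shortZ Q n ⊆ (P.circ Q).EU n := by
  rintro _ ⟨i, j, hij, hij', a, ha, b, hb, c, h⟩
  have hc : c ∈ (whole F).lev j i := (mem_lev_short fun h => hij' (eq_opp_comm.1 h)).2 trivial
  rcases h with rfl | rfl
  · exact Z_mem_EU hij ((mem_lev_short hij').2 (mul_mem_circ ha hb)) hc
  · exact Z_mem_EU hij ((mem_lev_short hij').2 (mul_mem_circ' ha hb)) hc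

theorem longZ_subset_EU_circ : P.longZ Q n ⊆ (P.circ Q).EU n := by
  rintro _ ⟨i, a, ha, c, hc, rfl⟩
  exact Z_mem_EU i.opp_ne.symm ha hc

theorem commY_eq {i j : Idx n} {g : (Matrix (Idx n) (Idx n) A)ˣ} (hij : i ≠ j)
    (hg : g ∈ P.commY Q i j) :
    ∃ x ∈ P.rootGroup (-root i j), ∃ y ∈ Q.rootGroup (root i j), g = ⁅x, y⁆ := by
  obtain ⟨a, ha, b, hb, rfl⟩ := hg
  rw [neg_root]
  exact ⟨_, T_mem_rootGroup hij.symm ha, _, T_mem_rootGroup hij hb, rfl⟩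

theorem commY_subset_commutator {i j : Idx n} (hij : i ≠ j) :
    P.commY Q i j ⊆ (⁅P.EU n, Q.EU n⁆ : Subgroup (Matrix (Idx n) (Idx n) A)ˣ) := by
  rintro g hg
  obtain ⟨x, hx, y, hy, rfl⟩ := commY_eq hij hg
  exact Subgroup.commutator_mem_commutator (FU_le_EU (rootGroup_le_FU _ hx))
    (FU_le_EU (rootGroup_le_FU _ hy))

/-! ### Moving elementary commutators between roots -/

theorem commutator_FU_mem_of_opposite {H : Subgroup (Matrix (Idx n) (Idx n) A)ˣ}
    (hK : (P.circ Q).EU n ≤ H)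
    (hE : F.absEU n ≤ Subgroup.normalizer (H : Set (Matrix (Idx n) (Idx n) A)ˣ))
    {v : Fin n → ℤ} (h : ∀ x ∈ P.rootGroup (-v), ∀ y ∈ Q.rootGroup v, ⁅x, y⁆ ∈ H) :
    P.FU n ≤ centMod H (Q.rootGroup v) := by
  refine FU_le_of_rootGroup_le fun w x hx => ⟨rootGroup_le_normalizer hE w hx, fun y hy => ?_⟩
  by_cases hw : w + v = 0
  · obtain rfl := eq_neg_of_add_eq_zero_left hw
    exact h x hx y hy
  · exact hK (commutator_mem_EU_circ hw hx hy)

/-- If the root subgroup for `e_i - e_k` commutes with `FU` modulo `H`, then so does that for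
`e_i - e_j`, as `T_ij` is a commutator of `T_ik` and `T_kj(1)`. -/
theorem FU_le_centMod_short {H : Subgroup (Matrix (Idx n) (Idx n) A)ˣ}
    (hK : (P.circ Q).EU n ≤ H)
    (hE : F.absEU n ≤ Subgroup.normalizer (H : Set (Matrix (Idx n) (Idx n) A)ˣ))
    {i j k : Idx n} (hij : i ≠ j) (hij' : j ≠ i.opp) (h1 : k ≠ i) (h2 : k ≠ i.opp)
    (h3 : k ≠ j) (h4 : k ≠ j.opp) (h : P.FU n ≤ centMod H (Q.rootGroup (root i k))) :
    P.FU n ≤ centMod H (Q.rootGroup (root i j)) := by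
  refine commutator_FU_mem_of_opposite hK hE fun x hx y hy => ?_
  obtain ⟨b, hb, rfl⟩ := exists_T_of_mem_rootGroup hij hy
  have hg : F.T i k b ∈ Q.rootGroup (root i k) :=
    T_mem_rootGroup h1.symm ((mem_lev_short h2).2 (lev_le_ideal hb))
  have e2 : j ≠ k.opp := fun h => h4 (eq_opp_comm.1 h)
  have hz : F.T k j 1 ∈ (whole F).rootGroup (root k j) :=
    T_mem_rootGroup h3 ((mem_lev_short e2).2 trivial)
  have nz := rootGroup_le_normalizer hE _ hz
  have key : F.T i j b ∈ centMod H {x} := by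
    rw [T_short_eq hij hij' h1 h2 h3 h4]
    refine mul_mem ⟨rootGroup_le_normalizer hE _ hg, ?_⟩
      ⟨mul_mem (mul_mem nz (inv_mem (rootGroup_le_normalizer hE _ hg))) (inv_mem nz), ?_⟩
    · rintro _ rfl
      exact commutator_mem_comm.1 ((h (rootGroup_le_FU _ hx)).2 _ hg)
    · rintro _ rfl
      rw [commutator_mem_comm, commutator_conj_mem' nz]
      refine (h ?_).2 _ (inv_mem hg)
      have hne : root k j + -root i j ≠ 0 := by
        intro h0
        have := congrArg k.coord h0
        have e1 : i ≠ k.opp := fun h => h2 (eq_opp_comm.1 h)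
        simp [coord_root, coord_vec, h1.symm, h3.symm, e1, e2] at this
      have := conj_mem_FU hne (inv_mem hz) hx
      rwa [inv_inv] at this
  exact commutator_mem_comm.1 (key.2 x rfl)

/-- The analogue for long roots: the root subgroup for `2 e_k` commuting with `FU` modulo `H` is
enough for that of any other long root. -/
theorem FU_le_centMod_long {H : Subgroup (Matrix (Idx n) (Idx n) A)ˣ}
    (hK : (P.circ Q).EU n ≤ H)
    (hE : F.absEU n ≤ Subgroup.normalizer (H : Set (Matrix (Idx n) (Idx n) A)ˣ))
    {j k : Idx n} (hkj : k ≠ j) (hkj' : j ≠ k.opp)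
    (h : P.FU n ≤ centMod H (Q.rootGroup (root k k.opp))) :
    P.FU n ≤ centMod H (Q.rootGroup (root j.opp j)) := by
  refine commutator_FU_mem_of_opposite hK hE fun x hx y hy => ?_
  obtain ⟨a, ha, rfl⟩ := exists_T_of_mem_rootGroup j.opp_ne hy
  obtain ⟨b, hb, e⟩ := T_long_eq hkj hkj' ha
  have hg : F.T k k.opp b ∈ Q.rootGroup (root k k.opp) := T_mem_rootGroup k.opp_ne.symm hb
  have hs : F.T k j b ∈ Q.rootGroup (root k j) :=
    T_mem_rootGroup hkj ((mem_lev_short hkj').2 (lev_le_ideal hb))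
  have hz : F.T k.opp j 1 ∈ (whole F).rootGroup (root k.opp j) :=
    T_mem_rootGroup hkj'.symm ((mem_lev_short (by rw [opp_opp]; exact hkj.symm)).2 trivial)
  have nz := rootGroup_le_normalizer hE _ hz
  have e1 : j.opp ≠ k := fun h => hkj' (eq_opp_comm.1 h.symm)
  have e2 : j.opp ≠ k.opp := fun h => hkj (opp_inj.1 h).symm
  have key : F.T j.opp j a ∈ centMod H {x} := by
    rw [e]
    refine mul_mem (inv_mem ⟨rootGroup_le_normalizer hE _ hs, ?_⟩)
      (mul_mem ⟨rootGroup_le_normalizer hE _ hg, ?_⟩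
      ⟨mul_mem (mul_mem nz (inv_mem (rootGroup_le_normalizer hE _ hg))) (inv_mem nz), ?_⟩)
    · rintro _ rfl
      rw [commutator_mem_comm]
      refine hK (commutator_mem_EU_circ ?_ hx hs)
      intro h0
      have := congrArg k.coord h0
      simp [coord_root, coord_vec, hkj.symm, hkj', e1, e2] at this
    · rintro _ rfl
      exact commutator_mem_comm.1 ((h (rootGroup_le_FU _ hx)).2 _ hg)
    · rintro _ rfl
      rw [commutator_mem_comm, commutator_conj_mem' nz]
      refine (h ?_).2 _ (inv_mem hg)
      have hne : root k.opp j + -root j.opp j ≠ 0 := by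
        intro h0
        have := congrArg k.coord h0
        simp [coord_root, coord_vec, hkj.symm, hkj', e1, e2, k.opp_ne] at this
      have := conj_mem_FU hne (inv_mem hz) hx
      rwa [inv_inv] at this
  exact commutator_mem_comm.1 (key.2 x rfl)

/-- A symmetric relation on indices, thought of as a set of short roots `e_p + e_q`, which allows the
exchange of one index holds for all short roots as soon as it holds for one of them. -/
theorem forall_short_of_exchange (hn : 3 ≤ n) {r : Idx n → Idx n → Prop}
    (symm : ∀ p q, r p q → r q p)
    (step : ∀ p q s, s ≠ p → s ≠ p.opp → s ≠ q → s ≠ q.opp → q ≠ p → q ≠ p.opp → r p q → r p s)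
    {p q : Idx n} (hpq : q ≠ p) (hpq' : q ≠ p.opp) (h : r p q) {s t : Idx n} (hst : t ≠ s)
    (hst' : t ≠ s.opp) : r s t := by
  have one : ∀ p q s, q ≠ p → q ≠ p.opp → s ≠ p → s ≠ p.opp → r p q → r p s := by
    intro p q s h1 h2 h3 h4 h
    by_cases h5 : s = q
    · rwa [h5]
    by_cases h6 : s = q.opp
    · obtain ⟨m, hm1, hm2, hm3, hm4⟩ := exists_third hn p q
      have := step p q m hm1 hm2 hm3 hm4 h1 h2 h
      refine step p m s h3 h4 ?_ ?_ hm1 hm2 this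
      · rintro rfl
        exact hm4 h6
      · rw [h6]
        exact fun h => hm3 (opp_inj.1 h).symm
    · exact step p q s h3 h4 h5 h6 h1 h2 h
  have sw : ∀ {a b : Idx n}, a ≠ b.opp → b ≠ a.opp := fun h h' => h (eq_opp_comm.1 h')
  by_cases h1 : s = p ∨ s = p.opp
  · have ht : t ≠ p ∧ t ≠ p.opp := by
      rcases h1 with rfl | rfl
      · exact ⟨hst, hst'⟩
      · rw [opp_opp] at hst'
        exact ⟨hst', hst⟩
    have := symm _ _ (one p q t hpq hpq' ht.1 ht.2 h)
    exact symm _ _ (one t p s ht.1.symm (sw ht.2) hst.symm (sw hst') this)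
  · rw [not_or] at h1
    have := symm _ _ (one p q s hpq hpq' h1.1 h1.2 h)
    exact one s p t (Ne.symm h1.1) (sw h1.2) hst hst' this

/-- Modulo the symmetrised product, all elementary commutators are generated by those for one short
and one long root. -/
theorem FU_le_centMod_FU (hn : 3 ≤ n) {H : Subgroup (Matrix (Idx n) (Idx n) A)ˣ}
    (hK : (P.circ Q).EU n ≤ H)
    (hE : F.absEU n ≤ Subgroup.normalizer (H : Set (Matrix (Idx n) (Idx n) A)ˣ))
    {h k l : Idx n} (hhk : h ≠ k) (hhk' : h ≠ k.opp)
    (hY : P.commY Q h k ⊆ H) (hY' : P.commY Q l l.opp ⊆ H) :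
    P.FU n ≤ centMod H (Q.FU n) := by
  have start : ∀ i j : Idx n, i ≠ j → P.commY Q i j ⊆ H →
      P.FU n ≤ centMod H (Q.rootGroup (root i j)) := by
    intro i j hij hY
    refine commutator_FU_mem_of_opposite hK hE fun x hx y hy => ?_
    rw [neg_root] at hx
    obtain ⟨a, ha, rfl⟩ := exists_T_of_mem_rootGroup hij.symm hx
    obtain ⟨b, hb, rfl⟩ := exists_T_of_mem_rootGroup hij hy
    exact hY ⟨a, ha, b, hb, rfl⟩
  have sw : ∀ {a b : Idx n}, a ≠ b.opp → b ≠ a.opp := fun h h' => h (eq_opp_comm.1 h')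
  have short : ∀ i j : Idx n, i ≠ j → j ≠ i.opp →
      P.FU n ≤ centMod H (Q.rootGroup (root i j)) := by
    intro i j hij hij'
    have hop : ∀ {a b : Idx n}, a ≠ b → a.opp ≠ b.opp := fun h h' => h (opp_inj.1 h')
    have := forall_short_of_exchange hn
      (r := fun p q => P.FU n ≤ centMod H (Q.rootGroup (root p q.opp))) ?_ ?_
      (p := h) (q := k.opp) (s := i) (t := j.opp) hhk'.symm (hop hhk.symm) ?_
      (fun h => hij' (eq_opp_comm.1 h.symm)) (hop hij.symm)
    · simpa only [opp_opp] using this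
    · intro p q h
      rwa [← root_opp, opp_opp] at h
    · intro p q s h1 h2 h3 h4 h5 h6 h
      exact FU_le_centMod_short hK hE (sw h2) (hop h1) (fun e => h6 (by rw [← e, opp_opp]))
        (hop h5) (hop h3.symm) (by rw [opp_opp]; exact fun e => h4 e.symm) h
    · simp only [opp_opp]
      exact start h k hhk hY
  have long : ∀ i : Idx n, P.FU n ≤ centMod H (Q.rootGroup (root i i.opp)) := by
    have step : ∀ i k : Idx n, k ≠ i → k ≠ i.opp →
        P.FU n ≤ centMod H (Q.rootGroup (root k k.opp)) →
        P.FU n ≤ centMod H (Q.rootGroup (root i i.opp)) := by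
      intro i k h1 h2 h
      have := FU_le_centMod_long hK hE h2 (fun e => h1 (opp_inj.1 e).symm) h
      rwa [opp_opp] at this
    have h0 := start l l.opp l.opp_ne.symm hY'
    intro i
    by_cases h1 : i = l ∨ i = l.opp
    · obtain ⟨m, hm1, hm2, -, -⟩ := exists_third hn l l
      have h2 := step m l hm1.symm (sw hm2) h0
      rcases h1 with rfl | rfl
      · exact h0
      · exact step l.opp m hm2 (by rwa [opp_opp]) h2
    · rw [not_or] at h1
      exact step i l (Ne.symm h1.1) (sw h1.2) h0
  refine fun x hx => ⟨hE (FU_le_absEU hx), fun y hy => ?_⟩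
  refine commutator_mem_of_mem_closure (Y := {g | ∃ i j : Idx n, i ≠ j ∧ ∃ a ∈ F.level Q.I Q.Gam i j,
    g = F.T i j a}) ?_ ?_ hy
  · rintro _ ⟨i, j, hij, b, hb, rfl⟩
    exact rootGroup_le_normalizer (P := Q) hE _ (T_mem_rootGroup hij hb)
  · rintro _ ⟨i, j, hij, b, hb, rfl⟩
    have hT := T_mem_rootGroup (P := Q) hij hb
    by_cases hij' : j = i.opp
    · subst hij'
      exact (long i hx).2 _ hT
    · exact (short i j hij hij' hx).2 _ hT

/-! ### The mixed commutator subgroup of the relative groups -/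

/-- If the unrelative groups commute modulo `H`, then so do the relative ones. An elementary
conjugate for the root `v` is treated by moving the conjugation to the other argument, which is
harmless unless this belongs to the same root `v`; in that case the transvection for `v` is first
generated from other roots. -/
theorem commutator_EU_le (hn : 3 ≤ n) {H : Subgroup (Matrix (Idx n) (Idx n) A)ˣ}
    (hE : F.absEU n ≤ Subgroup.normalizer (H : Set (Matrix (Idx n) (Idx n) A)ˣ))
    (h : P.FU n ≤ centMod H (Q.FU n)) : ⁅P.EU n, Q.EU n⁆ ≤ H := by
  have nr : ∀ {v : Fin n → ℤ}, (whole F).rootGroup v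
      ≤ Subgroup.normalizer (H : Set (Matrix (Idx n) (Idx n) A)ˣ) :=
    fun {v} => rootGroup_le_normalizer hE v
  have nQ : ∀ {v : Fin n → ℤ}, Q.rootGroup v
      ≤ Subgroup.normalizer (H : Set (Matrix (Idx n) (Idx n) A)ˣ) :=
    fun {v} => rootGroup_le_normalizer hE v
  -- root subgroups against conjugates for a different root
  have diff : ∀ {u w : Fin n → ℤ}, u ≠ w → ∀ x ∈ P.rootGroup w, ∀ g ∈ Q.conjSet u,
      ⁅x, g⁆ ∈ H := by
    rintro u w huw x hx _ ⟨t, ht, y, hy, rfl⟩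
    rw [commutator_conj_mem' (nr ht)]
    have hne : -u + w ≠ 0 := fun h0 => huw (neg_add_eq_zero.1 h0)
    have := conj_mem_FU hne (inv_mem ht) hx
    rw [inv_inv] at this
    exact (h this).2 y (rootGroup_le_FU _ hy)
  have same : ∀ {v : Fin n → ℤ}, ∀ x ∈ P.rootGroup v, ∀ g ∈ Q.conjSet v, ⁅x, g⁆ ∈ H := by
    intro v x hx g hg
    rcases eq_one_or_exists_T hx with rfl | ⟨i, j, hij, rfl, -⟩
    · simp
    obtain ⟨R, hR1, -, hR3, hR⟩ := exists_generating_roots F hn hij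
    set S : Set (Fin n → ℤ) := {root i j} ∪ {u | -u ∈ R}
    have hS : ∀ u ∈ R, u ∉ S := by
      rintro u hu (rfl | h)
      · exact hR1 hu
      · exact hR3 u hu h
    have hN := hR P (centMod H (Q.genConj S)) ?_ ?_ hx
    · exact hN.2 g (conjSet_subset_genConj (Or.inl rfl) hg)
    · refine fun w hw x hx => ⟨rootGroup_le_normalizer hE w hx, fun g hg => ?_⟩
      refine commutator_mem_of_mem_closure
        (Y := {g | ∃ v : Fin n → ℤ, g ∈ Q.rootGroup v} ∪ {g | ∃ v ∈ S, g ∈ Q.conjSet v}) ?_ ?_ hg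
      · rintro g (⟨v, hg⟩ | ⟨v, -, t, ht, y, hy, rfl⟩)
        · exact nQ hg
        · exact mul_mem (mul_mem (nr ht) (nQ hy)) (inv_mem (nr ht))
      · rintro g (⟨v, hg⟩ | ⟨v, hv, hg⟩)
        · exact (h (rootGroup_le_FU _ hx)).2 g (rootGroup_le_FU _ hg)
        · exact diff (fun e => hS w hw (by rwa [← e])) x hx g hg
    · intro w hw z hz
      exact normalizer_le_normalizer_centMod (nr hz) (rootGroup_le_normalizer_genConj (hS w hw)
        (Or.inr (by simpa only [Set.mem_ofPred_eq, neg_neg] using hw)) hz)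
  have hEU : P.EU n ≤ centMod H (Q.FU n) := by
    rw [EU_eq_genConj hn]
    refine (Subgroup.closure_le _).2 ?_
    rintro g (⟨v, hg⟩ | ⟨v, -, t, ht, x, hx, rfl⟩)
    · exact h (rootGroup_le_FU _ hg)
    · refine ⟨mul_mem (mul_mem (nr ht) (rootGroup_le_normalizer hE v hx)) (inv_mem (nr ht)),
        fun g hg => ?_⟩
      refine commutator_mem_of_mem_closure
        (Y := {g | ∃ i j : Idx n, i ≠ j ∧ ∃ a ∈ F.level Q.I Q.Gam i j, g = F.T i j a}) ?_ ?_ hg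
      · rintro _ ⟨i, j, hij, b, hb, rfl⟩
        exact nQ (T_mem_rootGroup hij hb)
      · rintro _ ⟨i, j, hij, b, hb, rfl⟩
        have hT := T_mem_rootGroup (P := Q) hij hb
        rw [commutator_conj_mem (nr ht)]
        by_cases hv : root i j = v
        · rw [hv] at hT
          exact same x hx _ ⟨t⁻¹, inv_mem ht, _, hT, by rw [inv_inv]⟩
        · have hne : -v + root i j ≠ 0 := fun h0 => hv (neg_add_eq_zero.1 h0).symm
          have := conj_mem_FU hne (inv_mem ht) hT
          rw [inv_inv] at this
          exact (h (rootGroup_le_FU _ hx)).2 _ this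
  refine Subgroup.commutator_le.2 fun x hx y hy => ?_
  refine commutator_mem_of_mem_closure
    (Y := {g | ∃ e ∈ F.absEU n, ∃ y ∈ Q.FU n, g = e * y * e⁻¹}) ?_ ?_ hy
  · rintro _ ⟨e, he, y, hy, rfl⟩
    exact mul_mem (mul_mem (hE he) (hE (FU_le_absEU hy))) (inv_mem (hE he))
  · rintro _ ⟨e, he, y, hy, rfl⟩
    rw [commutator_conj_mem' (hE he)]
    exact (hEU (Subgroup.conj_mem_of_mem_normalizer' (absEU_le_normalizer_EU he) hx)).2 y hy

theorem commutator_EU_eq_closure (hn : 3 ≤ n) {h k : Idx n} (hhk : h ≠ k) (hhk' : h ≠ k.opp)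
    (l : Idx n) : ⁅P.EU n, Q.EU n⁆ = Subgroup.closure (P.shortZ Q n ∪ P.longZ Q n ∪
      (P.commY Q h k ∪ P.commY Q l l.opp)) := by
  set X := P.shortZ Q n ∪ P.longZ Q n ∪ (P.commY Q h k ∪ P.commY Q l l.opp)
  have hsub : X ⊆ Subgroup.closure X := Subgroup.subset_closure
  have hK : (P.circ Q).EU n ≤ Subgroup.closure X :=
    EU_circ_le_of_subset hn (fun g hg => hsub (Or.inl (Or.inl hg)))
      (fun g hg => hsub (Or.inl (Or.inr hg)))
  apply le_antisymm
  · have hE : F.absEU n ≤ Subgroup.normalizer (Subgroup.closure X : Set _) := by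
      refine Subgroup.le_normalizer_closure fun z hz g hg => ?_
      have hY : ∀ i j : Idx n, i ≠ j → g ∈ P.commY Q i j → z * g * z⁻¹ ∈ Subgroup.closure X := by
        intro i j hij hgY
        obtain ⟨x, hx, y, hy, rfl⟩ := commY_eq hij hgY
        rw [conj_eq_commutator_mul]
        exact mul_mem (hK ((absEU_le_centMod_commutator hn hx hy hz).2 _ rfl)) (hsub hg)
      rcases hg with (hg | hg) | (hg | hg)
      · exact hK (Subgroup.conj_mem_of_mem_normalizer (absEU_le_normalizer_EU hz)
          (shortZ_subset_EU_circ hg))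
      · exact hK (Subgroup.conj_mem_of_mem_normalizer (absEU_le_normalizer_EU hz)
          (longZ_subset_EU_circ hg))
      · exact hY h k hhk hg
      · exact hY l l.opp l.opp_ne.symm hg
    exact commutator_EU_le hn hE (FU_le_centMod_FU hn hK hE hhk hhk'
      (fun g hg => hsub (Or.inr (Or.inl hg))) (fun g hg => hsub (Or.inr (Or.inr hg))))
  · refine (Subgroup.closure_le _).2 ?_
    rintro g ((hg | hg) | (hg | hg))
    · exact EU_circ_le_commutator hn (shortZ_subset_EU_circ hg)
    · exact EU_circ_le_commutator hn (longZ_subset_EU_circ hg)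
    · exact commY_subset_commutator hhk hg
    · exact commY_subset_commutator l.opp_ne.symm hg

end FormIdeal

theorem theorem1 {A : Type*} [Ring A] [StarRing A] (F : FormRing A) (P Q : FormIdeal F)
    (n : ℕ) (hn : 3 ≤ n) :
    ⁅P.EU n, Q.EU n⁆ =
        Subgroup.closure (P.shortZ Q n ∪ P.longZ Q n ∪
          {g | ∃ i j : Idx n, i ≠ j ∧ g ∈ P.commY Q i j}) ∧
      ∀ h k l : Idx n, h ≠ k → h ≠ k.opp →
        ⁅P.EU n, Q.EU n⁆ =
          Subgroup.closure (P.shortZ Q n ∪ P.longZ Q n ∪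
            (P.commY Q h k ∪ P.commY Q l l.opp)) := by
  have part : ∀ h k l : Idx n, h ≠ k → h ≠ k.opp → ⁅P.EU n, Q.EU n⁆ =
      Subgroup.closure (P.shortZ Q n ∪ P.longZ Q n ∪ (P.commY Q h k ∪ P.commY Q l l.opp)) :=
    fun h k l hhk hhk' => FormIdeal.commutator_EU_eq_closure hn hhk hhk' l
  refine ⟨le_antisymm ?_ ?_, part⟩
  · let h : Idx n := Sum.inl ⟨0, by omega⟩
    obtain ⟨k, h1, h2, -, -⟩ := FormIdeal.exists_third hn h h
    rw [part h k h h1.symm fun e => h2 (Idx.eq_opp_comm.1 e)]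
    refine Subgroup.closure_mono (Set.union_subset_union_right _ ?_)
    rintro g (hg | hg)
    · exact ⟨h, k, h1.symm, hg⟩
    · exact ⟨h, h.opp, h.opp_ne.symm, hg⟩
  · refine (Subgroup.closure_le _).2 ?_
    rintro g ((hg | hg) | ⟨i, j, hij, hg⟩)
    · exact FormIdeal.EU_circ_le_commutator hn (FormIdeal.shortZ_subset_EU_circ hg)
    · exact FormIdeal.EU_circ_le_commutator hn (FormIdeal.longZ_subset_EU_circ hg)
    · exact FormIdeal.commY_subset_commutator hij hg
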